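/- An instance $I$ of Stable Matching consists of $n\ge 0$ men and $n$ women, where each man has a strictly ordered preference list of all women and each woman has one of all men. A matching is a set $M$ of man–woman pairs (edges of the complete bipartite graph) no two of which share a person; a pair $(m,w)$ blocks $M$ if $m$ prefers $w$ to his partner in $M$ and $w$ prefers $m$ to her partner in $M$ (a person without a partner in $M$ prefers everybody to being alone); $M$ is stable if no pair blocks it. The input size of $I$ is $N=1+2n^2$ words: the number $n$ and the entries of the $2n$ lists. Linear time is meant on a random access machine with unit-cost instructions (assignment, addition, truncated subtraction, multiplication, indirect load and store, comparisons of registers, conditionals and loops), where for a constant $c$ depending only on the program, every word holds a natural number that is at most $cN$ or at most the largest input word. **Theorem.** There are such a program and a constant $c$ such that, for every instance $I$, the program on input $I$ halts after at most $cN$ steps and outputs a set of pairwise edge-disjoint stable matchings of $I$ that has the largest size among all such sets. **Corollary.** Disjoint Stable Matchings is solvable in linear time: there are such a program and a constant $c$ such that, for every instance $I$ and every natural number $k$ (one additional input word, so that the input has $N+1$ words and $N$ is replaced by $N+1$ in the bounds), the program halts after at most $c(N+1)$ steps, correctly decides whether $I$ has at least $k$ pairwise edge-disjoint stable matchings, and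 if so outputs a set of at least $k$ pairwise edge-disjoint stable matchings of $I$. -/

import Mathlib

/-! ### Stable matching instances -/

/-- An instance of stable matching: the complete bipartite graph on `n` men and `n` women, both
numbered `0, …, n - 1`, with complete strict preference lists. `manList m i` is the woman at
position `i` of the list of man `m` (position `0` is the most preferred), and `womanList w i` is
the man at position `i` of the list of woman `w`. -/
structure SMInstance where
  n : ℕ
  manList : Fin n → (Fin n ≃ Fin n)
  womanList : Fin n → (Fin n ≃ Fin n)

namespace SMInstance

/-- Man `m` prefers woman `w` to woman `w'`. -/
def ManPrefers (I : SMInstance) (m w w' : Fin I.n) : Prop :=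
  (I.manList m).symm w < (I.manList m).symm w'

/-- Woman `w` prefers man `m` to man `m'`. -/
def WomanPrefers (I : SMInstance) (w m m' : Fin I.n) : Prop :=
  (I.womanList w).symm m < (I.womanList w).symm m'

/-- The edges (man, woman) of the complete bipartite graph. -/
abbrev Edge (I : SMInstance) : Type := Fin I.n × Fin I.n

/-- A set of edges is a matching if no two distinct members share an end-vertex. -/
def IsMatching (I : SMInstance) (M : Finset I.Edge) : Prop :=
  ∀ e ∈ M, ∀ f ∈ M, e ≠ f → e.1 ≠ f.1 ∧ e.2 ≠ f.2

/-- The pair `(m, w)` blocks `M`: each of the two prefers the other to the partner in `M`, where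
somebody without a partner in `M` prefers everybody to staying alone. -/
def Blocks (I : SMInstance) (M : Finset I.Edge) (m w : Fin I.n) : Prop :=
  (∀ w', (m, w') ∈ M → I.ManPrefers m w w') ∧ (∀ m', (m', w) ∈ M → I.WomanPrefers w m m')

/-- Stable matchings. -/
def IsStable (I : SMInstance) (M : Finset I.Edge) : Prop :=
  I.IsMatching M ∧ ∀ m w, ¬ I.Blocks M m w

/-- `S` is a collection of pairwise edge-disjoint stable matchings. -/
def IsDisjointStable (I : SMInstance) (S : Finset (Finset I.Edge)) : Prop :=
  (∀ M ∈ S, I.IsStable M) ∧ ∀ M ∈ S, ∀ M' ∈ S, M ≠ M' → Disjoint M M'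

/-- `S` is such a collection of the largest possible size. -/
def IsLargestDisjointStable (I : SMInstance) (S : Finset (Finset I.Edge)) : Prop :=
  I.IsDisjointStable S ∧ ∀ S', I.IsDisjointStable S' → S'.card ≤ S.card

end SMInstance

/-! ### A random access machine with bounded words -/

/-- A configuration: registers and memory cells, all holding natural numbers. -/
structure RAMState where
  reg : ℕ → ℕ
  mem : ℕ → ℕ

/-- Tests that compare two registers. -/
inductive RAMTest : Type
  | lt (a b : ℕ)
  | eq (a b : ℕ)

/-- The test succeeds in the state `s`. -/
def RAMTest.Holds : RAMTest → RAMState → Prop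
  | .lt a b, s => s.reg a < s.reg b
  | .eq a b, s => s.reg a = s.reg b

/-- Programs. A program mentions finitely many registers; the memory is reached by `load` and
`store` only, at addresses that are held in registers. -/
inductive RAMProgram : Type
  /-- do nothing -/
  | skip
  /-- `r := k` -/
  | const (r k : ℕ)
  /-- `r := a` -/
  | move (r a : ℕ)
  /-- `r := a + b` -/
  | add (r a b : ℕ)
  /-- `r := a - b`, or `0` if `a < b` -/
  | sub (r a b : ℕ)
  /-- `r := a * b` -/
  | mul (r a b : ℕ)
  /-- `r := mem[a]` -/
  | load (r a : ℕ)
  /-- `mem[a] := b` -/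
  | store (a b : ℕ)
  /-- sequential composition -/
  | seq (p q : RAMProgram)
  /-- conditional -/
  | ite (c : RAMTest) (p q : RAMProgram)
  /-- loop -/
  | while (c : RAMTest) (p : RAMProgram)

/-- The state after writing `v` to register `r`. -/
def RAMState.setReg (s : RAMState) (r v : ℕ) : RAMState :=
  { s with reg := Function.update s.reg r v }

/-- The state after writing `v` to the memory cell `a`. -/
def RAMState.setMem (s : RAMState) (a v : ℕ) : RAMState :=
  { s with mem := Function.update s.mem a v }

/-- `RAMExec W p s t s'`: on a machine whose words hold the numbers `0, …, W`, the program `p`,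
started in `s`, halts in `s'` after exactly `t` steps. Every elementary instruction and every
evaluation of a test is one step. There is no execution in which an instruction would produce a
number greater than `W` (overflow). -/
inductive RAMExec (W : ℕ) : RAMProgram → RAMState → ℕ → RAMState → Prop
  | skip (s : RAMState) : RAMExec W .skip s 1 s
  | const (s : RAMState) (r k : ℕ) (h : k ≤ W) : RAMExec W (.const r k) s 1 (s.setReg r k)
  | move (s : RAMState) (r a : ℕ) (h : s.reg a ≤ W) :
      RAMExec W (.move r a) s 1 (s.setReg r (s.reg a))
  | add (s : RAMState) (r a b : ℕ) (h : s.reg a + s.reg b ≤ W) :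
      RAMExec W (.add r a b) s 1 (s.setReg r (s.reg a + s.reg b))
  | sub (s : RAMState) (r a b : ℕ) (h : s.reg a - s.reg b ≤ W) :
      RAMExec W (.sub r a b) s 1 (s.setReg r (s.reg a - s.reg b))
  | mul (s : RAMState) (r a b : ℕ) (h : s.reg a * s.reg b ≤ W) :
      RAMExec W (.mul r a b) s 1 (s.setReg r (s.reg a * s.reg b))
  | load (s : RAMState) (r a : ℕ) (h : s.mem (s.reg a) ≤ W) :
      RAMExec W (.load r a) s 1 (s.setReg r (s.mem (s.reg a)))
  | store (s : RAMState) (a b : ℕ) (h : s.reg b ≤ W) :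
      RAMExec W (.store a b) s 1 (s.setMem (s.reg a) (s.reg b))
  | seq {p q : RAMProgram} {s s' s'' : RAMState} {t t' : ℕ}
      (hp : RAMExec W p s t s') (hq : RAMExec W q s' t' s'') :
      RAMExec W (.seq p q) s (t + t') s''
  | ite_true {c : RAMTest} {p : RAMProgram} (q : RAMProgram) {s s' : RAMState} {t : ℕ}
      (hc : c.Holds s) (hp : RAMExec W p s t s') : RAMExec W (.ite c p q) s (1 + t) s'
  | ite_false {c : RAMTest} (p : RAMProgram) {q : RAMProgram} {s s' : RAMState} {t : ℕ}
      (hc : ¬ c.Holds s) (hq : RAMExec W q s t s') : RAMExec W (.ite c p q) s (1 + t) s'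
  | while_false {c : RAMTest} (p : RAMProgram) {s : RAMState}
      (hc : ¬ c.Holds s) : RAMExec W (.while c p) s 1 s
  | while_true {c : RAMTest} {p : RAMProgram} {s s' s'' : RAMState} {t t' : ℕ}
      (hc : c.Holds s) (hp : RAMExec W p s t s') (hw : RAMExec W (.while c p) s' t' s'') :
      RAMExec W (.while c p) s (1 + t + t') s''

/-- The initial state on the input `x`: the words of `x` are in the memory cells `0, 1, 2, …`, and
everything else is zero. -/
def RAMState.start (x : List ℕ) : RAMState where
  reg := fun _ => 0
  mem := fun a => x.getD a 0

/-- The output of a halted machine: register `0` holds the address of the first word of the output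
and register `1` holds the number of its words. -/
def RAMState.output (s : RAMState) : List ℕ :=
  (List.range (s.reg 1)).map fun i => s.mem (s.reg 0 + i)

/-- A computational task is given by the input words `input i` of each problem instance `i` and
by a relation `Correct i y` saying which outputs `y` are correct for `i`. It is solvable in linear
time if one program and one constant `c` serve for all instances: the program halts after at most
`c * N` steps, where `N` is the number of words of the input, and its output is correct. The words
are just large enough for numbers up to `c * N` and for the words of the input. -/
def SolvableInLinearTime {ι : Type} (input : ι → List ℕ) (Correct : ι → List ℕ → Prop) : Prop :=
  ∃ (p : RAMProgram) (c : ℕ), ∀ i : ι, ∃ (t : ℕ) (s : RAMState),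
    t ≤ c * (input i).length ∧
    RAMExec (max (c * (input i).length) ((input i).foldr max 0)) p
      (RAMState.start (input i)) t s ∧
    Correct i s.output

/-! ### Input and output of the two problems -/

namespace SMInstance

/-- The input words of an instance: the number `n`, the lists of the men, the lists of the
women (in total `1 + 2 * n ^ 2` words). -/
def encode (I : SMInstance) : List ℕ :=
  I.n ::
    ((List.finRange I.n).flatMap (fun m => (List.finRange I.n).map fun i => (I.manList m i : ℕ)) ++
    (List.finRange I.n).flatMap (fun w => (List.finRange I.n).map fun i => (I.womanList w i : ℕ)))

/-- The edge set in which each man `m` is joined to the woman `μ m`. -/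
def edgesOf (I : SMInstance) (μ : Fin I.n → Fin I.n) : Finset I.Edge :=
  Finset.univ.image fun m => (m, μ m)

/-- The words `y` list the collection `S` of edge sets without repetition: first the size of `S`,
then for each member of `S` the women joined to the men `0, …, n - 1`. -/
def Lists (I : SMInstance) (y : List ℕ) (S : Finset (Finset I.Edge)) : Prop :=
  ∃ L : List (Fin I.n → Fin I.n), L.Nodup ∧ S = (L.map I.edgesOf).toFinset ∧
    y = L.length :: L.flatMap (fun μ => (List.finRange I.n).map fun m => (μ m : ℕ))

end SMInstance

/-!
The algorithm runs the proposals of the men in phases. In a phase the men propose along their lists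
as in the algorithm of Gale and Shapley; when all are engaged, the engagements are output, all men
are set free, and in the next phase they continue in their lists, while a woman accepts only
proposals that are better than all that she has had before, including those of former phases. The
algorithm ends when some man has tried all women.

A phase that comes to an end yields a stable matching (`PhaseInvariant.isStableMap`): all women
that a man has passed over have got better partners. It is disjoint from the former ones because
every man has made a further proposal (`PhaseHistory.append`).

No algorithm finds more. Given pairwise disjoint stable matchings, let the `j`-th matching of a new
family give every man his `j`-th best partner. In each edge of a stable matching, one of the two
partners prefers it to a second, disjoint one and the other does not (`IsStableMap.opposed`), so a
woman gets her `j`-th worst partner, and the new family consists of disjoint stable matchings that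
get worse for all men (`exists_isStableChain`). For such a chain, no man is rejected in phase `j`
by his partner in the `j`-th matching: her better suitor would form a blocking pair with her. This
is the field `ptr_le_chain` of `PhaseInvariant`, preserved by `PhaseInvariant.reject` and
`PhaseInvariant.accept`. Hence the phases are at least as many as the members of the chain
(`PhaseInvariant.chain_le`).

For the running time, each man proposes to each woman at most once in the whole run, there are at
most `n + 1` phases, and everything else takes `O(n)` steps in each phase. A table of the women's
rankings, which is filled in `O(n ^ 2)` steps, makes a proposal a constant number of steps. On the
machine, the amortized count is kept by a potential in the invariants of the loops
(`RAMTerminates.while_of_potential`), and `Represents` says how the data of the algorithm lie in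
the memory. Without any people the phases would never end, and this case is treated apart.
-/

/-! ### Reasoning about the machine -/

/-- The program `p`, started in `s`, halts within the word size `W`, and the number of steps and
the final state satisfy `Q`. -/
def RAMTerminates (W : ℕ) (p : RAMProgram) (s : RAMState) (Q : ℕ → RAMState → Prop) : Prop :=
  ∃ t s', RAMExec W p s t s' ∧ Q t s'

namespace RAMTerminates

variable {W : ℕ} {s : RAMState} {Q Q' : ℕ → RAMState → Prop} {p q : RAMProgram} {c : RAMTest}

theorem mono (h : RAMTerminates W p s Q) (hQ : ∀ t s', Q t s' → Q' t s') :
    RAMTerminates W p s Q' :=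
  let ⟨t, s', he, hq⟩ := h
  ⟨t, s', he, hQ _ _ hq⟩

theorem skip_iff : RAMTerminates W .skip s Q ↔ Q 1 s := by
  constructor
  · rintro ⟨t, s', he, hq⟩; cases he; exact hq
  · exact fun h => ⟨_, _, .skip s, h⟩

theorem const_iff {r k : ℕ} :
    RAMTerminates W (.const r k) s Q ↔ k ≤ W ∧ Q 1 (s.setReg r k) := by
  constructor
  · rintro ⟨t, s', he, hq⟩; cases he; exact ⟨‹_›, hq⟩
  · exact fun h => ⟨_, _, .const s r k h.1, h.2⟩

theorem move_iff {r a : ℕ} :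
    RAMTerminates W (.move r a) s Q ↔ s.reg a ≤ W ∧ Q 1 (s.setReg r (s.reg a)) := by
  constructor
  · rintro ⟨t, s', he, hq⟩; cases he; exact ⟨‹_›, hq⟩
  · exact fun h => ⟨_, _, .move s r a h.1, h.2⟩

theorem add_iff {r a b : ℕ} :
    RAMTerminates W (.add r a b) s Q ↔
      s.reg a + s.reg b ≤ W ∧ Q 1 (s.setReg r (s.reg a + s.reg b)) := by
  constructor
  · rintro ⟨t, s', he, hq⟩; cases he; exact ⟨‹_›, hq⟩
  · exact fun h => ⟨_, _, .add s r a b h.1, h.2⟩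

theorem sub_iff {r a b : ℕ} :
    RAMTerminates W (.sub r a b) s Q ↔
      s.reg a - s.reg b ≤ W ∧ Q 1 (s.setReg r (s.reg a - s.reg b)) := by
  constructor
  · rintro ⟨t, s', he, hq⟩; cases he; exact ⟨‹_›, hq⟩
  · exact fun h => ⟨_, _, .sub s r a b h.1, h.2⟩

theorem mul_iff {r a b : ℕ} :
    RAMTerminates W (.mul r a b) s Q ↔
      s.reg a * s.reg b ≤ W ∧ Q 1 (s.setReg r (s.reg a * s.reg b)) := by
  constructor
  · rintro ⟨t, s', he, hq⟩; cases he; exact ⟨‹_›, hq⟩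
  · exact fun h => ⟨_, _, .mul s r a b h.1, h.2⟩

theorem load_iff {r a : ℕ} :
    RAMTerminates W (.load r a) s Q ↔
      s.mem (s.reg a) ≤ W ∧ Q 1 (s.setReg r (s.mem (s.reg a))) := by
  constructor
  · rintro ⟨t, s', he, hq⟩; cases he; exact ⟨‹_›, hq⟩
  · exact fun h => ⟨_, _, .load s r a h.1, h.2⟩

theorem store_iff {a b : ℕ} :
    RAMTerminates W (.store a b) s Q ↔
      s.reg b ≤ W ∧ Q 1 (s.setMem (s.reg a) (s.reg b)) := by
  constructor
  · rintro ⟨t, s', he, hq⟩; cases he; exact ⟨‹_›, hq⟩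
  · exact fun h => ⟨_, _, .store s a b h.1, h.2⟩

theorem seq_iff :
    RAMTerminates W (.seq p q) s Q ↔
      RAMTerminates W p s fun t s' => RAMTerminates W q s' fun t' => Q (t + t') := by
  constructor
  · rintro ⟨t, s', he, hq⟩
    cases he with
    | seq hp hq' => exact ⟨_, _, hp, _, _, hq', hq⟩
  · rintro ⟨t, s', hp, t', s'', hq, h⟩
    exact ⟨_, _, .seq hp hq, h⟩

theorem ite_iff :
    RAMTerminates W (.ite c p q) s Q ↔
      (c.Holds s → RAMTerminates W p s fun t => Q (1 + t)) ∧
      (¬ c.Holds s → RAMTerminates W q s fun t => Q (1 + t)) := by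
  constructor
  · rintro ⟨t, s', he, hq⟩
    cases he with
    | ite_true _ hc hp => exact ⟨fun _ => ⟨_, _, hp, hq⟩, fun h => absurd hc h⟩
    | ite_false _ hc hp => exact ⟨fun h => absurd h hc, fun _ => ⟨_, _, hp, hq⟩⟩
  · rintro ⟨h₁, h₂⟩
    by_cases hc : c.Holds s
    · obtain ⟨t, s', he, hq⟩ := h₁ hc
      exact ⟨_, _, .ite_true _ hc he, hq⟩
    · obtain ⟨t, s', he, hq⟩ := h₂ hc
      exact ⟨_, _, .ite_false _ hc he, hq⟩

/-- The amortized rule for loops: `Inv k s` is the invariant, in which `k` is a potential that pays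
for the remaining iterations. -/
theorem while_of_potential (Inv : ℕ → RAMState → Prop)
    (step : ∀ k s, Inv k s → c.Holds s →
      RAMTerminates W p s fun t s' => ∃ k', Inv k' s' ∧ t + 1 + k' ≤ k) :
    ∀ k s, Inv k s → RAMTerminates W (.while c p) s fun t s' =>
      ∃ k', Inv k' s' ∧ ¬ c.Holds s' ∧ t + k' ≤ k + 1 := by
  intro k
  induction k using Nat.strong_induction_on with
  | _ k ih =>
    intro s hs
    by_cases hc : c.Holds s
    · obtain ⟨t, s', he, k', hI, hk⟩ := step k s hs hc
      obtain ⟨t', s'', he', k'', hI', hc', hk'⟩ := ih k' (by omega) s' hI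
      exact ⟨_, _, .while_true hc he he', k'', hI', hc', by omega⟩
    · exact ⟨1, s, .while_false _ hc, k, hs, hc, by omega⟩

end RAMTerminates

namespace RAMState

theorem reg_setReg (s : RAMState) (r v a : ℕ) :
    (s.setReg r v).reg a = if a = r then v else s.reg a := by
  simp [setReg, Function.update_apply]

theorem mem_setReg (s : RAMState) (r v : ℕ) : (s.setReg r v).mem = s.mem := rfl

theorem reg_setMem (s : RAMState) (r v : ℕ) : (s.setMem r v).reg = s.reg := rfl

theorem mem_setMem (s : RAMState) (r v a : ℕ) :
    (s.setMem r v).mem a = if a = r then v else s.mem a := by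
  simp [setMem, Function.update_apply]

end RAMState

namespace SMInstance

variable (I : SMInstance)

/-! ### Stable matchings as injective maps -/

/-- The position of woman `w` in the list of man `m`. -/
def manRank (m w : Fin I.n) : ℕ := (I.manList m).symm w

/-- The position of man `m` in the list of woman `w`. -/
def womanRank (w m : Fin I.n) : ℕ := (I.womanList w).symm m

variable {I}

theorem manRank_lt (m w : Fin I.n) : I.manRank m w < I.n := Fin.is_lt _

theorem womanRank_lt (w m : Fin I.n) : I.womanRank w m < I.n := Fin.is_lt _

theorem manRank_inj {m w w' : Fin I.n} : I.manRank m w = I.manRank m w' ↔ w = w' := by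
  simp [manRank, Fin.val_inj]

theorem womanRank_inj {w m m' : Fin I.n} : I.womanRank w m = I.womanRank w m' ↔ m = m' := by
  simp [womanRank, Fin.val_inj]

@[simp] theorem manRank_manList (m i : Fin I.n) : I.manRank m (I.manList m i) = i := by
  simp [manRank]

@[simp] theorem womanRank_womanList (w i : Fin I.n) : I.womanRank w (I.womanList w i) = i := by
  simp [womanRank]

variable (I) in
/-- `μ` assigns partners to the men in a stable way: it is injective (hence a perfect matching),
and whenever a woman, here the partner `μ m'` of `m'`, is preferred by `m` to his own partner, she
prefers `m'` to `m`. -/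
def IsStableMap (μ : Fin I.n → Fin I.n) : Prop :=
  Function.Injective μ ∧ ∀ m m', I.manRank m (μ m') < I.manRank m (μ m) →
    I.womanRank (μ m') m' < I.womanRank (μ m') m

theorem mem_edgesOf {μ : Fin I.n → Fin I.n} {m w : Fin I.n} :
    (m, w) ∈ I.edgesOf μ ↔ μ m = w := by
  simp [edgesOf]

theorem edgesOf_injective : Function.Injective I.edgesOf := by
  intro μ ν h
  funext m
  have : (m, μ m) ∈ I.edgesOf ν := h ▸ mem_edgesOf.2 rfl
  exact (mem_edgesOf.1 this).symm

theorem IsStableMap.isStable {μ : Fin I.n → Fin I.n} (h : I.IsStableMap μ) :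
    I.IsStable (I.edgesOf μ) := by
  refine ⟨?_, ?_⟩
  · rintro ⟨m, w⟩ hm ⟨m', w'⟩ hm' hne
    rw [mem_edgesOf] at hm hm'
    subst hm hm'
    refine ⟨fun he => hne ?_, fun he => hne ?_⟩
    · simp only at he
      subst he; rfl
    · have := h.1 he
      subst this; rfl
  · rintro m w ⟨h₁, h₂⟩
    obtain ⟨m', rfl⟩ := (Finite.injective_iff_surjective.1 h.1) w
    have h₁ := h₁ _ (mem_edgesOf.2 rfl)
    have h₂ := h₂ _ (mem_edgesOf.2 rfl)
    exact lt_asymm h₂ (h.2 m m' h₁)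

/-- A stable matching is perfect: a single man would leave a single woman, and the two would
block. -/
theorem IsStable.exists_map {M : Finset I.Edge} (h : I.IsStable M) :
    ∃ μ, I.IsStableMap μ ∧ M = I.edgesOf μ := by
  classical
  obtain ⟨hM, hB⟩ := h
  have fst_inj : Set.InjOn Prod.fst (M : Set I.Edge) := fun e he f hf hef => by
    by_contra hne
    exact (hM e he f hf hne).1 hef
  have snd_inj : Set.InjOn Prod.snd (M : Set I.Edge) := fun e he f hf hef => by
    by_contra hne
    exact (hM e he f hf hne).2 hef
  have hcard : (M.image Prod.fst).card = (M.image Prod.snd).card := by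
    rw [Finset.card_image_of_injOn fst_inj, Finset.card_image_of_injOn snd_inj]
  have hmen : ∀ m, ∃ w, (m, w) ∈ M := by
    by_contra! hm
    obtain ⟨m, hm⟩ := hm
    have hw : ∃ w, w ∉ M.image Prod.snd := by
      by_contra! hw
      have h₁ : M.image Prod.snd = Finset.univ := Finset.eq_univ_iff_forall.2 hw
      rw [h₁, Finset.card_univ, Fintype.card_fin] at hcard
      have h₂ : M.image Prod.fst = Finset.univ :=
        Finset.eq_univ_of_card _ (by rw [hcard, Fintype.card_fin])
      have h₃ := Finset.mem_univ m
      rw [← h₂, Finset.mem_image] at h₃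
      obtain ⟨⟨a, b⟩, he, rfl⟩ := h₃
      exact hm b he
    obtain ⟨w, hw⟩ := hw
    refine hB m w ⟨fun w' h' => absurd h' (hm w'), fun m' h' => absurd ?_ hw⟩
    exact Finset.mem_image_of_mem Prod.snd h'
  choose μ hμ using hmen
  have hM' : M = I.edgesOf μ := by
    ext ⟨m, w⟩
    rw [mem_edgesOf]
    constructor
    · intro hm
      have := fst_inj hm (hμ m) rfl
      simpa using this.symm
    · rintro rfl
      exact hμ m
  refine ⟨μ, ⟨fun m m' hmm => ?_, fun m m' hlt => ?_⟩, hM'⟩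
  · simpa using congrArg Prod.fst (snd_inj (hμ m) (hμ m') hmm)
  · by_contra hle
    refine hB m (μ m') ⟨fun w' hw' => ?_, fun x hx => ?_⟩
    · rw [hM', mem_edgesOf] at hw'
      subst hw'
      exact hlt
    · have hx' : x = m' := by simpa using congrArg Prod.fst (snd_inj hx (hμ m') rfl)
      subst hx'
      have hne : m ≠ x := by
        rintro rfl
        exact lt_irrefl _ hlt
      have : I.womanRank (μ x) m ≠ I.womanRank (μ x) x := fun h => hne (womanRank_inj.1 h)
      change I.womanRank (μ x) m < I.womanRank (μ x) x
      omega

/-! ### Disjoint stable matchings form a chain after sorting -/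

/-- If `μ` and `ν` are disjoint stable matchings, then of the two partners in an edge of `μ`, one
prefers `μ` and the other prefers `ν`. Here `m` and `m'` are the partners in `μ` and `ν` of the
same woman. The reason is that `ν⁻¹ ∘ μ` permutes the men who prefer `μ`. -/
theorem IsStableMap.opposed {μ ν : Fin I.n → Fin I.n} (hμ : I.IsStableMap μ)
    (hν : I.IsStableMap ν) (hd : ∀ m, μ m ≠ ν m) {m m' : Fin I.n} (hm : μ m = ν m') :
    I.manRank m (μ m) < I.manRank m (ν m) ↔ I.womanRank (μ m) m' < I.womanRank (μ m) m := by
  classical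
  constructor
  · intro h
    rw [hm] at h ⊢
    exact hν.2 m m' h
  intro hw
  by_contra hnot
  have hbij := Finite.injective_iff_bijective.1 hν.1
  let e : Fin I.n ≃ Fin I.n := Equiv.ofBijective ν hbij
  have he : ∀ x, ν (e.symm (μ x)) = μ x := fun x => e.apply_symm_apply (μ x)
  let A : Finset (Fin I.n) :=
    Finset.univ.filter fun x => I.manRank x (μ x) < I.manRank x (ν x)
  have hA : ∀ x ∈ A, e.symm (μ x) ∈ A := by
    intro x hx
    simp only [A, Finset.mem_filter, Finset.mem_univ, true_and] at hx ⊢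
    have h₁ := hν.2 x (e.symm (μ x))
    rw [he] at h₁
    have h₂ := h₁ hx
    have h₃ := hμ.2 (e.symm (μ x)) x
    rw [he]
    by_contra hle
    have hne : I.manRank (e.symm (μ x)) (μ x) ≠
        I.manRank (e.symm (μ x)) (μ (e.symm (μ x))) := by
      rw [Ne, manRank_inj]
      exact fun h => hd _ (h.symm.trans (he x).symm)
    exact lt_asymm h₂ (h₃ (lt_of_le_of_ne (not_lt.1 hle) hne))
  have hinj : Set.InjOn (fun x => e.symm (μ x)) (A : Set (Fin I.n)) := fun x _ y _ h =>
    hμ.1 (e.symm.injective h)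
  have hsurj := Finset.surj_on_of_inj_on_of_card_le (s := A) (t := A)
    (fun x _ => e.symm (μ x)) hA (fun x y hx hy h => hinj hx hy h) le_rfl
  have hm' : m' ∉ A := by
    intro hmem
    obtain ⟨x, hx, hxe⟩ := hsurj m' hmem
    have : μ x = μ m := by rw [hm, hxe, he]
    rw [hμ.1 this] at hx
    exact hnot (by simpa [A] using hx)
  simp only [A, Finset.mem_filter, Finset.mem_univ, true_and, not_lt] at hm'
  have hne : I.manRank m' (ν m') ≠ I.manRank m' (μ m') := by
    rw [Ne, manRank_inj]
    exact fun h => hd _ h.symm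
  have := hμ.2 m' m (by rw [hm]; exact lt_of_le_of_ne hm' hne)
  exact lt_asymm hw this

variable (I) in
/-- `N 0, …, N (K - 1)` are stable matchings, each of them strictly worse than the preceding one
for every man. -/
structure IsStableChain (K : ℕ) (N : ℕ → Fin I.n → Fin I.n) : Prop where
  stable : ∀ j < K, I.IsStableMap (N j)
  lt_succ : ∀ j, j + 1 < K → ∀ m, I.manRank m (N j m) < I.manRank m (N (j + 1) m)

/-- In a finite set with an injective rank, every number below the cardinality occurs as the number
of elements of smaller rank. -/
theorem exists_card_filter_lt_eq {α : Type*} [DecidableEq α] (T : Finset α) (f : α → ℕ)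
    (hf : Set.InjOn f T) {j : ℕ} (hj : j < T.card) :
    ∃ a ∈ T, (T.filter fun b => f b < f a).card = j := by
  have hmono : ∀ a ∈ T, ∀ b ∈ T, f a < f b →
      (T.filter fun x => f x < f a).card < (T.filter fun x => f x < f b).card := by
    intro a ha b hb hab
    refine Finset.card_lt_card ⟨fun x hx => ?_, fun h => ?_⟩
    · simp only [Finset.mem_filter] at hx ⊢
      exact ⟨hx.1, hx.2.trans hab⟩
    · simpa using h (Finset.mem_filter.2 ⟨ha, hab⟩)
  obtain ⟨a, ha, h⟩ := Finset.surj_on_of_inj_on_of_card_le (s := T) (t := Finset.range T.card)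
    (fun a _ => (T.filter fun b => f b < f a).card)
    (fun a ha => by
      rw [Finset.mem_range]
      refine Finset.card_lt_card ⟨Finset.filter_subset _ _, fun h => ?_⟩
      simpa using h ha)
    (fun a b ha hb h => by
      by_contra hne
      rcases lt_or_gt_of_ne (fun h => hne (hf ha hb h)) with hlt | hlt
      · exact (hmono a ha b hb hlt).ne h
      · exact (hmono b hb a ha hlt).ne' h)
    (by simp) j (by simpa using hj)
  exact ⟨a, ha, h.symm⟩

/-- Giving every man his `j`-th best partner among pairwise disjoint stable matchings yields a
stable matching again: by `IsStableMap.opposed` his partner then gets her `j`-th worst one. -/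
theorem exists_isStableChain (T : Finset (Fin I.n → Fin I.n)) (hT : ∀ μ ∈ T, I.IsStableMap μ)
    (hd : ∀ μ ∈ T, ∀ ν ∈ T, μ ≠ ν → ∀ m, μ m ≠ ν m) :
    ∃ N, I.IsStableChain T.card N := by
  classical
  have hinj : ∀ m, Set.InjOn (fun μ : Fin I.n → Fin I.n => I.manRank m (μ m)) T := by
    intro m μ hμ ν hν h
    by_contra hne
    exact hd μ hμ ν hν hne m (manRank_inj.1 h)
  have hex : ∀ j m, ∃ μ, j < T.card →
      μ ∈ T ∧ (T.filter fun ν => I.manRank m (ν m) < I.manRank m (μ m)).card = j := by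
    intro j m
    by_cases hj : j < T.card
    · obtain ⟨μ, h⟩ := exists_card_filter_lt_eq T _ (hinj m) hj
      exact ⟨μ, fun _ => h⟩
    · exact ⟨id, fun h => absurd h hj⟩
  choose ρ hρ using hex
  have hinv : ∀ μ, ∃ g : Fin I.n → Fin I.n, μ ∈ T → ∀ w, μ (g w) = w := by
    intro μ
    by_cases hμ : μ ∈ T
    · obtain ⟨g, hg⟩ := (Finite.injective_iff_surjective.1 (hT μ hμ).1).hasRightInverse
      exact ⟨g, fun _ => hg⟩
    · exact ⟨id, fun h => absurd h hμ⟩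
  choose g hg using hinv
  -- the matchings that the woman `μ m` likes less than `μ` are those that `m` prefers to `μ`
  have hcount : ∀ μ ∈ T, ∀ m, (T.filter fun ν => I.womanRank (μ m) m <
      I.womanRank (μ m) (g ν (μ m))) =
      T.filter fun ν => I.manRank m (ν m) < I.manRank m (μ m) := by
    intro μ hμ m
    refine Finset.filter_congr fun ν hν => ?_
    by_cases hne : μ = ν
    · subst hne
      have : g μ (μ m) = m := (hT μ hμ).1 (hg μ hμ _)
      simp [this]
    · have hopp := (hT μ hμ).opposed (hT ν hν) (hd μ hμ ν hν hne) (hg ν hν (μ m)).symm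
      have h₁ : I.manRank m (μ m) ≠ I.manRank m (ν m) := fun h =>
        hd μ hμ ν hν hne m (manRank_inj.1 h)
      have h₂ : I.womanRank (μ m) (g ν (μ m)) ≠ I.womanRank (μ m) m := by
        rw [Ne, womanRank_inj]
        intro h
        have := hg ν hν (μ m)
        rw [h] at this
        exact hd μ hμ ν hν hne m this.symm
      omega
  -- the same count determines the partner of a woman
  have hwinj : ∀ μ ∈ T, ∀ ν ∈ T, ∀ m m', μ m = ν m' →
      (T.filter fun κ => I.manRank m (κ m) < I.manRank m (μ m)).card =
      (T.filter fun κ => I.manRank m' (κ m') < I.manRank m' (ν m')).card → m = m' := by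
    intro μ hμ ν hν m m' hw hc
    rw [← hcount μ hμ, ← hcount ν hν, ← hw] at hc
    have key : ∀ a b : Fin I.n, (∃ κ ∈ T, g κ (μ m) = b) →
        I.womanRank (μ m) a < I.womanRank (μ m) b →
        (T.filter fun κ => I.womanRank (μ m) b < I.womanRank (μ m) (g κ (μ m))).card <
        (T.filter fun κ => I.womanRank (μ m) a < I.womanRank (μ m) (g κ (μ m))).card := by
      rintro a b ⟨κ, hκ, hb⟩ hab
      refine Finset.card_lt_card ⟨fun x hx => ?_, fun h => ?_⟩
      · simp only [Finset.mem_filter] at hx ⊢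
        exact ⟨hx.1, hab.trans hx.2⟩
      · have := h (Finset.mem_filter.2 ⟨hκ, by rwa [hb]⟩)
        simp [hb] at this
    have hm : g μ (μ m) = m := (hT μ hμ).1 (hg μ hμ _)
    have hm' : g ν (μ m) = m' := (hT ν hν).1 ((hg ν hν _).trans hw)
    by_contra hne
    rcases lt_or_gt_of_ne (fun h => hne (womanRank_inj.1 h) :
      I.womanRank (μ m) m ≠ I.womanRank (μ m) m') with hlt | hlt
    · exact (key _ _ ⟨ν, hν, hm'⟩ hlt).ne' hc
    · exact (key _ _ ⟨μ, hμ, hm⟩ hlt).ne hc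
  refine ⟨fun j m => ρ j m m, fun j hj => ⟨fun m m' h => ?_, fun m m' hlt => ?_⟩,
    fun j hj m => ?_⟩
  · exact hwinj _ (hρ j m hj).1 _ (hρ j m' hj).1 m m' h
      ((hρ j m hj).2.trans (hρ j m' hj).2.symm)
  · by_contra hle
    obtain ⟨hμ, hcμ⟩ := hρ j m hj
    obtain ⟨hν, hcν⟩ := hρ j m' hj
    set μ := ρ j m
    set ν := ρ j m'
    change I.manRank m (ν m') < I.manRank m (μ m) at hlt
    change ¬ I.womanRank (ν m') m' < I.womanRank (ν m') m at hle
    -- the `T.card - j` matchings that are not better than `μ` for `m` are all strictly better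
    -- than `ν` for the woman `ν m'`, who has only `T.card - 1 - j` such matchings
    rw [← hcount ν hν] at hcν
    have hsub : (T.filter fun κ => ¬ I.manRank m (κ m) < I.manRank m (μ m)) ⊂
        T.filter fun κ => ¬ I.womanRank (ν m') m' < I.womanRank (ν m') (g κ (ν m')) := by
      have hlt' : ∀ κ ∈ T, ¬ I.manRank m (κ m) < I.manRank m (μ m) →
          I.womanRank (ν m') (g κ (ν m')) < I.womanRank (ν m') m := by
        intro κ hκ hk
        have := (hT κ hκ).2 m (g κ (ν m'))
        rw [hg κ hκ] at this
        exact this (by omega)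
      refine ⟨fun κ hκ => ?_, fun h => ?_⟩
      · simp only [Finset.mem_filter] at hκ ⊢
        have := hlt' κ hκ.1 hκ.2
        exact ⟨hκ.1, by omega⟩
      · have hm' : g ν (ν m') = m' := (hT ν hν).1 (hg ν hν _)
        have h₁ := h (Finset.mem_filter.2 ⟨hν, by rw [hm']; exact lt_irrefl _⟩)
        have h₂ := hlt' ν hν (Finset.mem_filter.1 h₁).2
        rw [hm'] at h₂
        omega
    have h₁ := Finset.card_lt_card hsub
    have h₂ := Finset.card_filter_add_card_filter_not (s := T)
      (fun κ => I.manRank m (κ m) < I.manRank m (μ m))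
    have h₃ := Finset.card_filter_add_card_filter_not (s := T)
      (fun κ => I.womanRank (ν m') m' < I.womanRank (ν m') (g κ (ν m')))
    omega
  · obtain ⟨hμ, hcμ⟩ := hρ j m (by omega)
    obtain ⟨hν, hcν⟩ := hρ (j + 1) m hj
    by_contra hle
    have : (T.filter fun κ => I.manRank m (κ m) < I.manRank m (ρ (j + 1) m m)).card ≤
        (T.filter fun κ => I.manRank m (κ m) < I.manRank m (ρ j m m)).card := by
      refine Finset.card_le_card fun κ hκ => ?_
      simp only [Finset.mem_filter] at hκ ⊢
      exact ⟨hκ.1, by omega⟩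
    omega

/-- Any family of disjoint stable matchings gives a chain of the same length. -/
theorem IsDisjointStable.exists_isStableChain {S : Finset (Finset I.Edge)}
    (hS : I.IsDisjointStable S) : ∃ N, I.IsStableChain S.card N := by
  classical
  have hmap : ∀ M : Finset I.Edge, ∃ μ, M ∈ S → I.IsStableMap μ ∧ M = I.edgesOf μ := by
    intro M
    by_cases hM : M ∈ S
    · obtain ⟨μ, h⟩ := (hS.1 M hM).exists_map
      exact ⟨μ, fun _ => h⟩
    · exact ⟨id, fun h => absurd h hM⟩
  choose φ hφ using hmap
  have hinj : Set.InjOn φ S := fun M hM M' hM' h => by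
    rw [(hφ M hM).2, (hφ M' hM').2, h]
  rw [← Finset.card_image_of_injOn hinj]
  refine SMInstance.exists_isStableChain _ ?_ ?_
  · intro μ hμ
    obtain ⟨M, hM, rfl⟩ := Finset.mem_image.1 hμ
    exact (hφ M hM).1
  · intro μ hμ ν hν hne m h
    obtain ⟨M, hM, rfl⟩ := Finset.mem_image.1 hμ
    obtain ⟨M', hM', rfl⟩ := Finset.mem_image.1 hν
    have hMM : M ≠ M' := fun h => hne (by rw [h])
    have hdis := hS.2 M hM M' hM' hMM
    refine Finset.disjoint_left.1 hdis (?_ : (m, φ M m) ∈ M) ?_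
    · have h' : (m, φ M m) ∈ I.edgesOf (φ M) := mem_edgesOf.2 rfl
      rwa [← (hφ M hM).2] at h'
    · rw [(hφ M' hM').2]
      exact mem_edgesOf.2 h.symm

end SMInstance

namespace SMInstance

/-! ### Phases of proposals -/

/-- The data of the proposal algorithm: the number `ptr m` of proposals that man `m` has made, the
position `bnd w` of the best man who has proposed to woman `w` (`n` if there was none), and the
number `stp w` of the last phase in which woman `w` accepted a proposal, counted from `1`. -/
@[ext] structure ProposalState (n : ℕ) where
  ptr : Fin n → ℕ
  bnd : Fin n → ℕ
  stp : Fin n → ℕ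

variable {I : SMInstance}

variable (I) in
/-- The invariant of phase `j` (counted from `0`), which started with the numbers `q` of proposals;
`A` is the set of the men who are engaged in this phase. -/
structure PhaseInvariant (j : ℕ) (q : Fin I.n → ℕ) (A : Finset (Fin I.n))
    (σ : ProposalState I.n) : Prop where
  ptr_le : ∀ m, σ.ptr m ≤ I.n
  bnd_le : ∀ w, σ.bnd w ≤ I.n
  stp_le : ∀ w, σ.stp w ≤ j + 1
  bnd_lt : ∀ w, σ.stp w = j + 1 → σ.bnd w < I.n
  /-- The partners of the women only improve, even across phases. -/
  bnd_le_of_proposed : ∀ m w, I.manRank m w < σ.ptr m → σ.bnd w ≤ I.womanRank w m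
  proposed_of_bnd_eq : ∀ m w, σ.bnd w = I.womanRank w m → I.manRank m w < σ.ptr m
  /-- A woman holds a proposal in this phase iff she is the last one her suitor has tried. -/
  engaged : ∀ m w, σ.stp w = j + 1 ∧ σ.bnd w = I.womanRank w m ↔
    m ∈ A ∧ I.manRank m w + 1 = σ.ptr m
  start_le : ∀ m, q m ≤ σ.ptr m
  start_lt : ∀ m ∈ A, q m < σ.ptr m
  /-- No man is rejected by the partner he has in the `j`-th member of a chain. -/
  ptr_le_chain : ∀ K N, I.IsStableChain K N → j < K → ∀ m,
    σ.ptr m ≤ I.manRank m (N j m) + 1 ∧ (m ∉ A → σ.ptr m ≤ I.manRank m (N j m))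

namespace PhaseInvariant

variable {j : ℕ} {q : Fin I.n → ℕ} {A : Finset (Fin I.n)} {σ : ProposalState I.n}

theorem init : I.PhaseInvariant 0 (fun _ => 0) ∅ ⟨fun _ => 0, fun _ => I.n, fun _ => 0⟩ where
  ptr_le := by simp
  bnd_le := by simp
  stp_le := by simp
  bnd_lt := by simp
  bnd_le_of_proposed := by simp
  proposed_of_bnd_eq m w h := absurd h (womanRank_lt w m).ne'
  engaged := by simp
  start_le := by simp
  start_lt := by simp
  ptr_le_chain := by simp

/-- At the end of a phase everybody is set free, and the men go on in their lists while the women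
insist on improving. -/
theorem next_phase (h : I.PhaseInvariant j q A σ) : I.PhaseInvariant (j + 1) σ.ptr ∅ σ where
  ptr_le := h.ptr_le
  bnd_le := h.bnd_le
  stp_le w := (h.stp_le w).trans (by omega)
  bnd_lt w hw := by have := h.stp_le w; omega
  bnd_le_of_proposed := h.bnd_le_of_proposed
  proposed_of_bnd_eq := h.proposed_of_bnd_eq
  engaged m w := by
    have := h.stp_le w
    simp only [Finset.notMem_empty, false_and, iff_false]
    omega
  start_le m := le_rfl
  start_lt := by simp
  ptr_le_chain K N hN hj m := by
    have h₁ := (h.ptr_le_chain K N hN (by omega) m).1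
    have h₂ := hN.lt_succ j hj m
    exact ⟨by omega, fun _ => by omega⟩

/-- A free man who has tried everybody shows that there is no chain longer than the number of the
phases completed so far. -/
theorem chain_le (h : I.PhaseInvariant j q A σ) {c : Fin I.n} (hc : c ∉ A) (hp : σ.ptr c = I.n)
    {K : ℕ} {N : ℕ → Fin I.n → Fin I.n} (hN : I.IsStableChain K N) : K ≤ j := by
  by_contra hK
  have h₁ := (h.ptr_le_chain K N hN (by omega) c).2 hc
  have h₂ := manRank_lt c (N j c)
  omega

/-- The man `c` proposes to the woman `w`, who has had a proposal at least as good. -/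
theorem reject (h : I.PhaseInvariant j q A σ) {c w : Fin I.n} (hc : c ∉ A)
    (hw : I.manRank c w = σ.ptr c) (hr : σ.bnd w ≤ I.womanRank w c) :
    I.PhaseInvariant j q A { σ with ptr := Function.update σ.ptr c (σ.ptr c + 1) } where
  ptr_le m := by
    have h₁ := h.ptr_le m
    have h₂ := manRank_lt c w
    simp only [Function.update_apply]
    split_ifs <;> omega
  bnd_le := h.bnd_le
  stp_le := h.stp_le
  bnd_lt := h.bnd_lt
  bnd_le_of_proposed m x hx := by
    simp only [Function.update_apply] at hx ⊢
    split_ifs at hx with hm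
    · subst hm
      by_cases hxw : x = w
      · subst hxw; exact hr
      · have : I.manRank m x ≠ I.manRank m w := fun h => hxw (manRank_inj.1 h)
        exact h.bnd_le_of_proposed m x (by omega)
    · exact h.bnd_le_of_proposed m x hx
  proposed_of_bnd_eq m x hx := by
    have := h.proposed_of_bnd_eq m x hx
    simp only [Function.update_apply]
    split_ifs with hm
    · subst hm; omega
    · exact this
  engaged m x := by
    rw [h.engaged m x]
    refine and_congr_right fun hm => ?_
    have hmc : m ≠ c := fun h => hc (h ▸ hm)
    simp only [Function.update_of_ne hmc]
  start_le m := by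
    have := h.start_le m
    simp only [Function.update_apply]
    split_ifs with hm
    · subst hm; omega
    · exact this
  start_lt m hm := by
    have hmc : m ≠ c := fun h => hc (h ▸ hm)
    simpa only [Function.update_of_ne hmc] using h.start_lt m hm
  ptr_le_chain K N hN hj m := by
    have hch := h.ptr_le_chain K N hN hj
    simp only [Function.update_apply]
    split_ifs with hm
    · subst hm
      suffices σ.ptr m + 1 ≤ I.manRank m (N j m) from ⟨by omega, fun _ => this⟩
      have h₁ := (hch m).2 hc
      by_contra hlt
      have hmw : I.manRank m (N j m) = I.manRank m w := by omega
      rw [manRank_inj] at hmw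
      -- the man who made the best proposal to `w` would block `N j` together with her
      have hbn : σ.bnd w < I.n := hr.trans_lt (womanRank_lt w m)
      obtain ⟨x, hx⟩ : ∃ x, σ.bnd w = I.womanRank w x :=
        ⟨I.womanList w ⟨_, hbn⟩, by simp⟩
      have hxp := h.proposed_of_bnd_eq x w hx
      have hxm : x ≠ m := by rintro rfl; omega
      have hst := hN.stable j hj
      have hne : I.manRank x (N j m) ≠ I.manRank x (N j x) := fun h =>
        hxm (hst.1 (manRank_inj.1 h)).symm
      have h₂ := (hch x).1
      have h₃ := hst.2 x m
      rw [hmw] at h₃ hne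
      have := h₃ (by omega)
      omega
    · exact hch m

/-- The man `c` proposes to the woman `w`, who accepts; her suitor of this phase, if there is one,
becomes free. -/
theorem accept (h : I.PhaseInvariant j q A σ) {c w : Fin I.n} (hc : c ∉ A)
    (hw : I.manRank c w = σ.ptr c) (hr : I.womanRank w c < σ.bnd w) {B : Finset (Fin I.n)}
    (hB : ∀ m, m ∈ B ↔
      m = c ∨ m ∈ A ∧ ¬ (σ.stp w = j + 1 ∧ σ.bnd w = I.womanRank w m)) :
    I.PhaseInvariant j q B
      { ptr := Function.update σ.ptr c (σ.ptr c + 1)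
        bnd := Function.update σ.bnd w (I.womanRank w c)
        stp := Function.update σ.stp w (j + 1) } where
  ptr_le m := by
    have h₁ := h.ptr_le m
    have h₂ := manRank_lt c w
    simp only [Function.update_apply]
    split_ifs <;> omega
  bnd_le x := by
    have h₁ := h.bnd_le x
    have h₂ := womanRank_lt w c
    simp only [Function.update_apply]
    split_ifs <;> omega
  stp_le x := by
    have h₁ := h.stp_le x
    simp only [Function.update_apply]
    split_ifs <;> omega
  bnd_lt x hx := by
    have h₁ := h.bnd_lt x
    have h₂ := womanRank_lt w c
    simp only [Function.update_apply] at hx ⊢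
    split_ifs at hx ⊢ <;> omega
  bnd_le_of_proposed m x hx := by
    simp only [Function.update_apply] at hx ⊢
    have h₁ := h.bnd_le_of_proposed m x
    have h₂ : I.manRank m x = I.manRank m w → x = w := manRank_inj.1
    by_cases hxw : x = w
    · subst hxw
      by_cases hm : m = c
      · subst hm
        simp
      · simp only [hm, if_true, if_false] at hx ⊢
        exact hr.le.trans (h₁ hx)
    · simp only [hxw, if_false] at hx ⊢
      by_cases hm : m = c
      · subst hm
        simp only [if_true] at hx
        have h₃ : I.manRank m x ≠ I.manRank m w := fun h => hxw (h₂ h)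
        exact h₁ (by omega)
      · simp only [hm, if_false] at hx
        exact h₁ hx
  proposed_of_bnd_eq m x hx := by
    simp only [Function.update_apply] at hx ⊢
    have h₁ := h.proposed_of_bnd_eq m x
    have h₂ : I.womanRank w c = I.womanRank w m → c = m := womanRank_inj.1
    by_cases hxw : x = w
    · subst hxw
      simp only [if_true] at hx
      have := h₂ hx
      subst this
      simp [hw]
    · simp only [hxw, if_false] at hx
      have := h₁ hx
      split_ifs with hm
      · subst hm
        omega
      · exact this
  engaged m x := by
    have h₁ := h.engaged m x
    have h₂ : I.manRank m x = I.manRank m w → x = w := manRank_inj.1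
    have h₃ : I.womanRank w c = I.womanRank w m → c = m := womanRank_inj.1
    have h₄ := hB m
    have h₅ := h.engaged m w
    simp only [Function.update_apply]
    by_cases hm : m = c
    · subst hm
      by_cases hxw : x = w
      · subst hxw
        simp only [if_true, h₄, true_or, true_and, hw]
      · simp only [hxw, if_true, if_false, h₄, true_or, true_and, h₁]
        exact ⟨fun h => absurd h.1 hc, fun h => absurd (h₂ (by omega)) hxw⟩
    · by_cases hxw : x = w
      · subst hxw
        simp only [if_true, if_false, hm, true_and, h₄, false_or]
        constructor
        · intro h
          exact absurd (h₃ h).symm hm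
        · rintro ⟨⟨h₆, h₇⟩, h₈⟩
          exact absurd (h₅.2 ⟨h₆, h₈⟩) h₇
      · simp only [if_false, hm, hxw, h₄, false_or, h₁]
        constructor
        · rintro ⟨h₆, h₇⟩
          refine ⟨⟨h₆, fun h₈ => hxw ?_⟩, h₇⟩
          have := (h₅.1 h₈).2
          exact h₂ (by omega)
        · rintro ⟨⟨h₆, _⟩, h₇⟩
          exact ⟨h₆, h₇⟩
  start_le m := by
    have := h.start_le m
    simp only [Function.update_apply]
    split_ifs with hm
    · subst hm; omega
    · exact this
  start_lt m hm := by
    have := h.start_le m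
    simp only [Function.update_apply]
    split_ifs with hmc
    · subst hmc; omega
    · rcases (hB m).1 hm with h' | h'
      · exact absurd h' hmc
      · exact h.start_lt m h'.1
  ptr_le_chain K N hN hj m := by
    have hch := h.ptr_le_chain K N hN hj
    have hcc := (hch c).2 hc
    simp only [Function.update_apply]
    split_ifs with hm
    · subst hm
      exact ⟨by omega, fun hmB => absurd ((hB m).2 (Or.inl rfl)) hmB⟩
    · refine ⟨(hch m).1, fun hmB => ?_⟩
      by_cases hmA : m ∈ A
      · -- `m` loses `w` to `c`; if `w` were his partner in `N j`, then `c` and `w` would block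
        have h₁ : σ.stp w = j + 1 ∧ σ.bnd w = I.womanRank w m := by
          by_contra hn
          exact hmB ((hB m).2 (Or.inr ⟨hmA, hn⟩))
        have h₂ := ((h.engaged m w).1 h₁).2
        by_contra hlt
        have h₃ := (hch m).1
        have hmw : I.manRank m (N j m) = I.manRank m w := by omega
        rw [manRank_inj] at hmw
        have hst := hN.stable j hj
        have hne : I.manRank c (N j m) ≠ I.manRank c (N j c) := fun h =>
          hm (hst.1 (manRank_inj.1 h))
        have h₄ := hst.2 c m
        rw [hmw] at h₄ hne
        have := h₄ (by omega)
        omega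
      · exact (hch m).2 hmA

/-- When all men are engaged, they form a stable matching. -/
theorem isStableMap (h : I.PhaseInvariant j q Finset.univ σ) {μ : Fin I.n → Fin I.n}
    (hμ : ∀ m, I.manRank m (μ m) + 1 = σ.ptr m) : I.IsStableMap μ := by
  have heng := fun m => (h.engaged m (μ m)).2 ⟨Finset.mem_univ m, hμ m⟩
  refine ⟨fun m m' hmm => ?_, fun m m' hlt => ?_⟩
  · have h₁ := (heng m).2
    have h₂ := (heng m').2
    rw [hmm] at h₁
    exact womanRank_inj.1 (h₁.symm.trans h₂)
  · have h₁ := (heng m').2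
    have h₂ := h.bnd_le_of_proposed m (μ m') (by have := hμ m; omega)
    have hne : I.womanRank (μ m') m' ≠ I.womanRank (μ m') m := fun he => by
      rw [womanRank_inj] at he
      subst he
      exact lt_irrefl _ hlt
    omega

end PhaseInvariant

variable (I) in
/-- `L` lists the pairwise disjoint stable matchings found in the first phases, after which the
numbers of proposals are `q`. -/
structure PhaseHistory (L : List (Fin I.n → Fin I.n)) (q : Fin I.n → ℕ) : Prop where
  stable : ∀ μ ∈ L, I.IsStableMap μ
  disjoint : L.Pairwise fun μ ν => ∀ m, μ m ≠ ν m
  lt : ∀ μ ∈ L, ∀ m, I.manRank m (μ m) < q m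
  length_le : ∀ m, L.length ≤ q m

theorem PhaseHistory.append {L : List (Fin I.n → Fin I.n)} {q : Fin I.n → ℕ}
    (hL : I.PhaseHistory L q) {σ : ProposalState I.n} {j : ℕ}
    (h : I.PhaseInvariant j q Finset.univ σ) {μ : Fin I.n → Fin I.n}
    (hμ : ∀ m, I.manRank m (μ m) + 1 = σ.ptr m) : I.PhaseHistory (L ++ [μ]) σ.ptr where
  stable ν hν := by
    rcases List.mem_append.1 hν with hν | hν
    · exact hL.stable ν hν
    · rw [List.mem_singleton.1 hν]
      exact h.isStableMap hμ
  disjoint := by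
    refine List.pairwise_append.2 ⟨hL.disjoint, List.pairwise_singleton _ _, ?_⟩
    intro ν hν κ hκ m he
    rw [List.mem_singleton.1 hκ] at he
    have h₁ := hL.lt ν hν m
    have h₂ := h.start_lt m (Finset.mem_univ m)
    have h₃ := hμ m
    rw [he] at h₁
    omega
  lt ν hν m := by
    have h₂ := h.start_lt m (Finset.mem_univ m)
    rcases List.mem_append.1 hν with hν | hν
    · exact (hL.lt ν hν m).trans h₂
    · rw [List.mem_singleton.1 hν, ← hμ m]
      exact Nat.lt_succ_self _
  length_le m := by
    have h₁ := hL.length_le m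
    have h₂ := h.start_lt m (Finset.mem_univ m)
    simp only [List.length_append, List.length_singleton]
    omega

variable (I) in
/-- `L` lists a largest set of disjoint stable matchings without repetition. -/
def IsSolution (L : List (Fin I.n → Fin I.n)) : Prop :=
  L.Nodup ∧ I.IsLargestDisjointStable (L.map I.edgesOf).toFinset

theorem card_edgesOf_toFinset {L : List (Fin I.n → Fin I.n)} (hL : L.Nodup) :
    (L.map I.edgesOf).toFinset.card = L.length := by
  rw [List.toFinset_card_of_nodup (hL.map edgesOf_injective), List.length_map]

theorem PhaseHistory.isSolution {L : List (Fin I.n → Fin I.n)} {q : Fin I.n → ℕ}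
    (hL : I.PhaseHistory L q) (hn : 0 < I.n)
    (hmax : ∀ K N, I.IsStableChain K N → K ≤ L.length) : I.IsSolution L := by
  have hnd : L.Nodup := hL.disjoint.imp fun h he => h ⟨0, hn⟩ (by rw [he])
  refine ⟨hnd, ⟨?_, ?_⟩, ?_⟩
  · intro M hM
    obtain ⟨μ, hμ, rfl⟩ : ∃ μ ∈ L, I.edgesOf μ = M := by simpa using hM
    exact (hL.stable μ hμ).isStable
  · intro M hM M' hM' hne
    obtain ⟨μ, hμ, rfl⟩ : ∃ μ ∈ L, I.edgesOf μ = M := by simpa using hM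
    obtain ⟨ν, hν, rfl⟩ : ∃ ν ∈ L, I.edgesOf ν = M' := by simpa using hM'
    rw [Finset.disjoint_left]
    rintro ⟨m, w⟩ h₁ h₂
    rw [mem_edgesOf] at h₁ h₂
    have : Std.Symm fun μ ν : Fin I.n → Fin I.n => ∀ m, μ m ≠ ν m :=
      ⟨fun _ _ h m => (h m).symm⟩
    exact hL.disjoint.forall hμ hν (fun h => hne (by rw [h])) m (h₁.trans h₂.symm)
  · intro S' hS'
    obtain ⟨N, hN⟩ := hS'.exists_isStableChain
    rw [card_edgesOf_toFinset hnd]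
    exact hmax _ _ hN

/-- Without any people, the empty matching is the only one. -/
theorem isSolution_of_n_eq_zero (hn : I.n = 0) (μ : Fin I.n → Fin I.n) : I.IsSolution [μ] := by
  have hE : ∀ M : Finset I.Edge, M = ∅ := fun M => by
    ext ⟨m, w⟩
    exact absurd m.isLt (by omega)
  refine ⟨List.nodup_singleton _, ⟨?_, ?_⟩, ?_⟩
  · intro M _
    refine ⟨?_, fun m => absurd m.isLt (by omega)⟩
    rw [hE M]
    simp [IsMatching]
  · intro M _ M' _ hne
    exact absurd ((hE M).trans (hE M').symm) hne
  · intro S' _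
    rw [card_edgesOf_toFinset (List.nodup_singleton _)]
    exact Finset.card_le_one.2 fun M _ M' _ => (hE M).trans (hE M').symm

end SMInstance

/-! ### The program -/

/-- Sequential composition of a list of programs. -/
def RAMProgram.block : List RAMProgram → RAMProgram
  | [] => .skip
  | p :: l => .seq p (block l)

namespace StableMatchingProgram

open RAMProgram

/-- Register `2` receives `n`, register `3` receives `1`, register `4` stays `0`. Registers `5` to
`10` receive the first addresses of the women's lists, of the table of the women's rankings, of the
arrays `ptr`, `bnd` and `stp`, and of the output. Register `11` receives the address of the next
output word; two words are left for the answer and for the number of matchings. -/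
def layout : RAMProgram :=
  block [.load 2 4, .const 3 1, .mul 14 2 2, .add 5 14 3, .add 6 5 14, .add 6 6 3, .add 7 6 14,
    .add 8 7 2, .add 9 8 2, .add 10 9 2, .const 11 2, .add 11 10 11]

/-- Fills one row of the ranking table: registers `15` and `22` hold the woman `w` and `w * n`. -/
def rankRow : RAMProgram :=
  .while (.lt 17 2) (block [.add 20 22 5, .add 20 20 17, .load 21 20, .add 23 22 6,
    .add 23 23 21, .store 23 17, .add 17 17 3])

/-- Inverts the women's lists and sets all `bnd` to `n`. -/
def rankTable : RAMProgram :=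
  .while (.lt 15 2) (block [.add 25 8 15, .store 25 2, .mul 22 15 2, .const 17 0, rankRow,
    .add 15 15 3])

/-- One proposal, by the man in register `16`, in the phase numbered by register `12`. Register `17`
is set to `0` if this leaves nobody to propose next; if the man has already tried everybody,
register `13` is set to `1`, and register `15` to `n` in order to leave the loop of the phase. -/
def propose : RAMProgram :=
  block [.add 18 7 16, .load 19 18,
    .ite (.eq 19 2)
      (block [.const 13 1, .const 17 0, .move 15 2])
      (block [.mul 20 16 2, .add 20 20 19, .add 20 20 3, .load 21 20,
        .mul 22 21 2, .add 23 22 6, .add 23 23 16, .load 24 23,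
        .add 25 8 21, .load 26 25, .add 27 9 21, .load 28 27, .add 19 19 3,
        .ite (.lt 24 26)
          (.ite (.eq 28 12)
            (block [.add 22 22 5, .add 22 22 26, .load 16 22, .store 18 19, .store 25 24])
            (block [.store 18 19, .store 25 24, .store 27 12, .const 17 0]))
          (.store 18 19)])]

/-- The men enter the phase one by one. -/
def phase : RAMProgram :=
  .while (.lt 15 2) (block [.move 16 15, .const 17 1, .while (.eq 17 3) propose, .add 15 15 3])

/-- Outputs the last women to whom the men have proposed. -/
def outputMatching : RAMProgram :=
  .while (.lt 15 2) (block [.add 18 7 15, .load 19 18, .mul 20 15 2, .add 20 20 19, .load 21 20,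
    .store 11 21, .add 11 11 3, .add 15 15 3])

/-- Repeats phases until some man has tried everybody. -/
def phases : RAMProgram :=
  .while (.eq 13 4) (block [.const 15 0, phase,
    .ite (.eq 13 4) (block [.const 15 0, outputMatching, .add 12 12 3]) .skip])

/-- Computes a largest list of disjoint stable matchings; register `12` ends as its length plus
one. If there are no people, the empty matching is the only one and occupies no output words. -/
def core : RAMProgram :=
  block [layout, rankTable, .const 12 1, .const 13 0, .ite (.eq 2 4) (.const 12 2) phases]

/-- Stores the number of matchings in front of them. -/
def storeCount : RAMProgram :=
  block [.sub 19 12 3, .add 18 10 3, .store 18 19]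

/-- The program that finds a largest collection. -/
def findLargest : RAMProgram :=
  block [core, storeCount, .move 0 18, .sub 1 11 18]

/-- The program that compares the number of matchings with the input `k`. -/
def decideCount : RAMProgram :=
  block [core, storeCount, .sub 20 6 3, .load 21 20, .move 0 10,
    .ite (.lt 19 21)
      (block [.const 1 1, .store 10 4])
      (block [.store 10 3, .sub 1 11 10])]

end StableMatchingProgram

namespace RAMTerminates

variable {W : ℕ} {s : RAMState} {Q : ℕ → RAMState → Prop} {p : RAMProgram} {l : List RAMProgram}

theorem block_nil : RAMTerminates W (.block []) s Q ↔ Q 1 s := skip_iff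

theorem block_cons : RAMTerminates W (.block (p :: l)) s Q ↔
    RAMTerminates W p s fun t s' => RAMTerminates W (.block l) s' fun t' => Q (t + t') := seq_iff

end RAMTerminates

/-! ### The memory layout -/

namespace SMInstance

variable (I : SMInstance)

/-- First address of the women's lists. -/
def womenBase : ℕ := I.n * I.n + 1

/-- First address of the women's rankings. The word before it is the input `k`. -/
def rankBase : ℕ := I.womenBase + I.n * I.n + 1

/-- First address of the array `ptr`. -/
def ptrBase : ℕ := I.rankBase + I.n * I.n

/-- First address of the array `bnd`. -/
def bndBase : ℕ := I.ptrBase + I.n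

/-- First address of the array `stp`. -/
def stpBase : ℕ := I.bndBase + I.n

/-- Address of the answer word, which is followed by the number of matchings and by the
matchings. -/
def outBase : ℕ := I.stpBase + I.n

/-- The state `s` represents the data `σ` of the algorithm. The rankings are known where `D` holds,
and the words `F` have been put out so far. -/
structure Represents (k : ℕ) (D : Fin I.n → Fin I.n → Prop) (F : List ℕ)
    (σ : ProposalState I.n) (s : RAMState) : Prop where
  reg_n : s.reg 2 = I.n
  reg_one : s.reg 3 = 1
  reg_zero : s.reg 4 = 0
  reg_women : s.reg 5 = I.womenBase
  reg_rank : s.reg 6 = I.rankBase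
  reg_ptr : s.reg 7 = I.ptrBase
  reg_bnd : s.reg 8 = I.bndBase
  reg_stp : s.reg 9 = I.stpBase
  reg_out : s.reg 10 = I.outBase
  reg_next : s.reg 11 = I.outBase + 2 + F.length
  mem_men : ∀ m i : Fin I.n, s.mem (m * I.n + i + 1) = I.manList m i
  mem_women : ∀ w i : Fin I.n, s.mem (w * I.n + I.womenBase + i) = I.womanList w i
  mem_k : s.mem (I.rankBase - 1) = k
  mem_rank : ∀ w m : Fin I.n, D w m → s.mem (w * I.n + I.rankBase + m) = I.womanRank w m
  mem_ptr : ∀ m : Fin I.n, s.mem (I.ptrBase + m) = σ.ptr m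
  mem_bnd : ∀ w : Fin I.n, s.mem (I.bndBase + w) = σ.bnd w
  mem_stp : ∀ w : Fin I.n, s.mem (I.stpBase + w) = σ.stp w
  mem_out : ∀ (i : ℕ) (h : i < F.length), s.mem (I.outBase + 2 + i) = F[i]

variable {I}

theorem index_lt (m i : Fin I.n) : m * I.n + i < I.n * I.n := by
  calc m * I.n + i < m * I.n + I.n := by omega
    _ = (m + 1) * I.n := by ring
    _ ≤ I.n * I.n := Nat.mul_le_mul_right _ m.isLt

theorem index_inj {m i m' i' : Fin I.n} (h : (m : ℕ) * I.n + i = m' * I.n + i') :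
    m = m' ∧ i = i' := by
  have hn : 0 < I.n := m.pos
  have h₁ := congrArg (· / I.n) h
  have h₂ := congrArg (· % I.n) h
  simp only [mul_comm _ I.n, Nat.mul_add_div hn, Nat.div_eq_of_lt i.isLt,
    Nat.div_eq_of_lt i'.isLt, add_zero] at h₁ h₂
  refine ⟨Fin.ext h₁, Fin.ext ?_⟩
  simpa [Nat.mul_add_mod, Nat.mod_eq_of_lt] using h₂

namespace Represents

variable {k : ℕ} {D : Fin I.n → Fin I.n → Prop} {F : List ℕ} {σ : ProposalState I.n}
  {s : RAMState}

theorem setReg (h : I.Represents k D F σ s) (r v : ℕ) (hr : r < 2 ∨ 11 < r) :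
    I.Represents k D F σ (s.setReg r v) := by
  have hreg : ∀ a, 2 ≤ a → a ≤ 11 → (s.setReg r v).reg a = s.reg a := fun a h₁ h₂ => by
    rw [RAMState.reg_setReg, if_neg (by omega)]
  exact
  { reg_n := (hreg 2 (by decide) (by decide)).trans h.reg_n
    reg_one := (hreg 3 (by decide) (by decide)).trans h.reg_one
    reg_zero := (hreg 4 (by decide) (by decide)).trans h.reg_zero
    reg_women := (hreg 5 (by decide) (by decide)).trans h.reg_women
    reg_rank := (hreg 6 (by decide) (by decide)).trans h.reg_rank
    reg_ptr := (hreg 7 (by decide) (by decide)).trans h.reg_ptr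
    reg_bnd := (hreg 8 (by decide) (by decide)).trans h.reg_bnd
    reg_stp := (hreg 9 (by decide) (by decide)).trans h.reg_stp
    reg_out := (hreg 10 (by decide) (by decide)).trans h.reg_out
    reg_next := (hreg 11 (by decide) (by decide)).trans h.reg_next
    mem_men := h.mem_men
    mem_women := h.mem_women
    mem_k := h.mem_k
    mem_rank := h.mem_rank
    mem_ptr := h.mem_ptr
    mem_bnd := h.mem_bnd
    mem_stp := h.mem_stp
    mem_out := h.mem_out }

/-- Writing to an address from `rankBase` on preserves the input. -/
theorem of_setMem (h : I.Represents k D F σ s) {a v : ℕ} (ha : I.rankBase ≤ a)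
    {D' : Fin I.n → Fin I.n → Prop} {σ' : ProposalState I.n}
    (h_rank : ∀ w m : Fin I.n, D' w m →
      (s.setMem a v).mem (w * I.n + I.rankBase + m) = I.womanRank w m)
    (h_ptr : ∀ m : Fin I.n, (s.setMem a v).mem (I.ptrBase + m) = σ'.ptr m)
    (h_bnd : ∀ w : Fin I.n, (s.setMem a v).mem (I.bndBase + w) = σ'.bnd w)
    (h_stp : ∀ w : Fin I.n, (s.setMem a v).mem (I.stpBase + w) = σ'.stp w)
    (h_out : ∀ (i : ℕ) (h : i < F.length), (s.setMem a v).mem (I.outBase + 2 + i) = F[i]) :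
    I.Represents k D' F σ' (s.setMem a v) where
  reg_n := h.reg_n
  reg_one := h.reg_one
  reg_zero := h.reg_zero
  reg_women := h.reg_women
  reg_rank := h.reg_rank
  reg_ptr := h.reg_ptr
  reg_bnd := h.reg_bnd
  reg_stp := h.reg_stp
  reg_out := h.reg_out
  reg_next := h.reg_next
  mem_men m i := by
    have := index_lt m i
    rw [RAMState.mem_setMem, if_neg (by unfold rankBase womenBase at ha; omega), h.mem_men]
  mem_women m i := by
    have := index_lt m i
    rw [RAMState.mem_setMem, if_neg (by unfold rankBase at ha; omega), h.mem_women]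
  mem_k := by
    have : 0 < I.rankBase := Nat.succ_pos _
    rw [RAMState.mem_setMem, if_neg (by omega), h.mem_k]
  mem_rank := h_rank
  mem_ptr := h_ptr
  mem_bnd := h_bnd
  mem_stp := h_stp
  mem_out := h_out

theorem setMem_rank (h : I.Represents k D F σ s) (w m : Fin I.n)
    {D' : Fin I.n → Fin I.n → Prop} (hD : ∀ x y, D' x y → D x y ∨ x = w ∧ y = m) :
    I.Represents k D' F σ (s.setMem (w * I.n + I.rankBase + m) (I.womanRank w m)) := by
  have hi := index_lt w m
  have e₁ : I.ptrBase = I.rankBase + I.n * I.n := rfl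
  have e₂ : I.bndBase = I.ptrBase + I.n := rfl
  have e₃ : I.stpBase = I.bndBase + I.n := rfl
  have e₄ : I.outBase = I.stpBase + I.n := rfl
  refine h.of_setMem (by omega) ?_ ?_ ?_ ?_ ?_
  · intro x y hxy
    rw [RAMState.mem_setMem]
    split_ifs with heq
    · obtain ⟨rfl, rfl⟩ := index_inj (show (x : ℕ) * I.n + y = w * I.n + m by omega)
      rfl
    · rcases hD x y hxy with hxy | ⟨rfl, rfl⟩
      · exact h.mem_rank x y hxy
      · exact absurd rfl heq
  · intro x
    rw [RAMState.mem_setMem, if_neg (by omega), h.mem_ptr]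
  · intro x
    rw [RAMState.mem_setMem, if_neg (by omega), h.mem_bnd]
  · intro x
    rw [RAMState.mem_setMem, if_neg (by omega), h.mem_stp]
  · intro i hi
    rw [RAMState.mem_setMem, if_neg (by omega), h.mem_out]

theorem setMem_ptr (h : I.Represents k D F σ s) (m : Fin I.n) (v : ℕ) :
    I.Represents k D F { σ with ptr := Function.update σ.ptr m v }
      (s.setMem (I.ptrBase + m) v) := by
  have e₁ : I.ptrBase = I.rankBase + I.n * I.n := rfl
  have e₂ : I.bndBase = I.ptrBase + I.n := rfl
  have e₃ : I.stpBase = I.bndBase + I.n := rfl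
  have e₄ : I.outBase = I.stpBase + I.n := rfl
  refine h.of_setMem (by omega) ?_ ?_ ?_ ?_ ?_
  · intro x y hxy
    have := index_lt x y
    rw [RAMState.mem_setMem, if_neg (by omega), h.mem_rank x y hxy]
  · intro x
    simp [RAMState.mem_setMem, Function.update_apply, h.mem_ptr, Fin.val_inj]
  · intro x
    rw [RAMState.mem_setMem, if_neg (by omega), h.mem_bnd]
  · intro x
    rw [RAMState.mem_setMem, if_neg (by omega), h.mem_stp]
  · intro i hi
    rw [RAMState.mem_setMem, if_neg (by omega), h.mem_out]

theorem setMem_bnd (h : I.Represents k D F σ s) (w : Fin I.n) (v : ℕ) :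
    I.Represents k D F { σ with bnd := Function.update σ.bnd w v }
      (s.setMem (I.bndBase + w) v) := by
  have e₁ : I.ptrBase = I.rankBase + I.n * I.n := rfl
  have e₂ : I.bndBase = I.ptrBase + I.n := rfl
  have e₃ : I.stpBase = I.bndBase + I.n := rfl
  have e₄ : I.outBase = I.stpBase + I.n := rfl
  refine h.of_setMem (by omega) ?_ ?_ ?_ ?_ ?_
  · intro x y hxy
    have := index_lt x y
    rw [RAMState.mem_setMem, if_neg (by omega), h.mem_rank x y hxy]
  · intro x
    rw [RAMState.mem_setMem, if_neg (by omega), h.mem_ptr]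
  · intro x
    simp [RAMState.mem_setMem, Function.update_apply, h.mem_bnd, Fin.val_inj]
  · intro x
    rw [RAMState.mem_setMem, if_neg (by omega), h.mem_stp]
  · intro i hi
    rw [RAMState.mem_setMem, if_neg (by omega), h.mem_out]

theorem setMem_stp (h : I.Represents k D F σ s) (w : Fin I.n) (v : ℕ) :
    I.Represents k D F { σ with stp := Function.update σ.stp w v }
      (s.setMem (I.stpBase + w) v) := by
  have e₁ : I.ptrBase = I.rankBase + I.n * I.n := rfl
  have e₂ : I.bndBase = I.ptrBase + I.n := rfl
  have e₃ : I.stpBase = I.bndBase + I.n := rfl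
  have e₄ : I.outBase = I.stpBase + I.n := rfl
  refine h.of_setMem (by omega) ?_ ?_ ?_ ?_ ?_
  · intro x y hxy
    have := index_lt x y
    rw [RAMState.mem_setMem, if_neg (by omega), h.mem_rank x y hxy]
  · intro x
    rw [RAMState.mem_setMem, if_neg (by omega), h.mem_ptr]
  · intro x
    rw [RAMState.mem_setMem, if_neg (by omega), h.mem_bnd]
  · intro x
    simp [RAMState.mem_setMem, Function.update_apply, h.mem_stp, Fin.val_inj]
  · intro i hi
    rw [RAMState.mem_setMem, if_neg (by omega), h.mem_out]

/-- Appending a word to the output. -/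
theorem append_out (h : I.Represents k D F σ s) (v : ℕ) :
    I.Represents k D (F ++ [v]) σ
      ((s.setMem (I.outBase + 2 + F.length) v).setReg 11 (I.outBase + 2 + F.length + 1)) := by
  have e₁ : I.ptrBase = I.rankBase + I.n * I.n := rfl
  have e₂ : I.bndBase = I.ptrBase + I.n := rfl
  have e₃ : I.stpBase = I.bndBase + I.n := rfl
  have e₄ : I.outBase = I.stpBase + I.n := rfl
  have h' : I.Represents k D F σ (s.setMem (I.outBase + 2 + F.length) v) := by
    refine h.of_setMem (by omega) ?_ ?_ ?_ ?_ ?_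
    · intro x y hxy
      have := index_lt x y
      rw [RAMState.mem_setMem, if_neg (by omega), h.mem_rank x y hxy]
    · intro x
      rw [RAMState.mem_setMem, if_neg (by omega), h.mem_ptr]
    · intro x
      rw [RAMState.mem_setMem, if_neg (by omega), h.mem_bnd]
    · intro x
      rw [RAMState.mem_setMem, if_neg (by omega), h.mem_stp]
    · intro i hi
      rw [RAMState.mem_setMem, if_neg (by omega), h.mem_out]
  have hreg : ∀ a b, a ≠ 11 → ((s.setMem (I.outBase + 2 + F.length) v).setReg 11 b).reg a =
      s.reg a := fun a b h₁ => by
    rw [RAMState.reg_setReg, if_neg h₁, RAMState.reg_setMem]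
  exact
  { reg_n := (hreg 2 _ (by decide)).trans h.reg_n
    reg_one := (hreg 3 _ (by decide)).trans h.reg_one
    reg_zero := (hreg 4 _ (by decide)).trans h.reg_zero
    reg_women := (hreg 5 _ (by decide)).trans h.reg_women
    reg_rank := (hreg 6 _ (by decide)).trans h.reg_rank
    reg_ptr := (hreg 7 _ (by decide)).trans h.reg_ptr
    reg_bnd := (hreg 8 _ (by decide)).trans h.reg_bnd
    reg_stp := (hreg 9 _ (by decide)).trans h.reg_stp
    reg_out := (hreg 10 _ (by decide)).trans h.reg_out
    reg_next := by simp [RAMState.reg_setReg, add_assoc]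
    mem_men := h'.mem_men
    mem_women := h'.mem_women
    mem_k := h'.mem_k
    mem_rank := h'.mem_rank
    mem_ptr := h'.mem_ptr
    mem_bnd := h'.mem_bnd
    mem_stp := h'.mem_stp
    mem_out := by
      intro i hi
      by_cases hiF : i < F.length
      · rw [List.getElem_append_left hiF]
        exact h'.mem_out i hiF
      · have : i = F.length := by simp at hi; omega
        subst this
        simp [RAMState.mem_setReg, RAMState.mem_setMem] }

end Represents

end SMInstance

namespace SMInstance

/-! ### The loop of proposals -/

open RAMTerminates StableMatchingProgram

variable {I : SMInstance}

/-- The number of proposals that can still be made, if man `m` has made `ptr m` of them. -/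
def remaining {n : ℕ} (ptr : Fin n → ℕ) : ℕ := ∑ m, (n - ptr m)

theorem remaining_update {n : ℕ} (ptr : Fin n → ℕ) (c : Fin n) (hc : ptr c < n) :
    remaining (Function.update ptr c (ptr c + 1)) + 1 = remaining ptr := by
  unfold remaining
  rw [← Finset.add_sum_erase _ _ (Finset.mem_univ c),
    ← Finset.add_sum_erase _ (fun m => n - ptr m) (Finset.mem_univ c)]
  have : ∑ m ∈ Finset.univ.erase c, (n - Function.update ptr c (ptr c + 1) m) =
      ∑ m ∈ Finset.univ.erase c, (n - ptr m) := by
    refine Finset.sum_congr rfl fun m hm => ?_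
    rw [Function.update_of_ne (Finset.ne_of_mem_erase hm)]
  simp only [this, Function.update_self]
  omega

variable (I) in
/-- The men with numbers below `m`. -/
def menBelow (m : ℕ) : Finset (Fin I.n) := Finset.univ.filter fun x => x.1 < m

/-- The invariant of the loop of proposals started by man `m` in phase `j`: some man `c` has to
propose, or the men up to `m` are engaged, or some man has tried everybody. The potential `κ`
allots `40` steps to each future proposal and `40` to the discovery of an exhausted list. -/
structure ProposeInvariant (I : SMInstance) (k j m : ℕ) (q : Fin I.n → ℕ) (F : List ℕ) (κ : ℕ)
    (s : RAMState) (σ : ProposalState I.n) (A : Finset (Fin I.n)) : Prop where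
  rep : I.Represents k (fun _ _ => True) F σ s
  inv : I.PhaseInvariant j q A σ
  reg_phase : s.reg 12 = j + 1
  cases :
    (s.reg 13 = 0 ∧ s.reg 17 = 1 ∧ s.reg 15 = m ∧ κ = 40 * remaining σ.ptr + 40 ∧
      ∃ c : Fin I.n, s.reg 16 = c ∧ c ∉ A ∧ insert c A = I.menBelow (m + 1)) ∨
    (s.reg 13 = 0 ∧ s.reg 17 = 0 ∧ s.reg 15 = m ∧ κ = 40 * remaining σ.ptr ∧
      A = I.menBelow (m + 1)) ∨
    (s.reg 13 = 1 ∧ s.reg 17 = 0 ∧ s.reg 15 = I.n ∧ κ = 40 * remaining σ.ptr ∧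
      ∀ K N, I.IsStableChain K N → K ≤ j)

/-- One proposal preserves the invariant at bounded cost. The bound on `W` makes room for all
addresses in use. -/
theorem propose_terminates {W k j m : ℕ} (hW : 20 * (2 * (I.n * I.n) + 1) ≤ W) (hj : j ≤ I.n)
    {q : Fin I.n → ℕ} {F : List ℕ} {κ : ℕ} {s : RAMState} {σ : ProposalState I.n}
    {A : Finset (Fin I.n)} (h : I.ProposeInvariant k j m q F κ s σ A) (h17 : s.reg 17 = 1) :
    RAMTerminates W propose s fun t s' =>
      ∃ κ', (∃ σ' A', I.ProposeInvariant k j m q F κ' s' σ' A') ∧ t + 1 + κ' ≤ κ := by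
  obtain ⟨hR, hI, h12, hcases⟩ := h
  obtain ⟨h13, -, h15, hκ, c, h16, hcA, hA⟩ : s.reg 13 = 0 ∧ s.reg 17 = 1 ∧ s.reg 15 = m ∧
      κ = 40 * remaining σ.ptr + 40 ∧ ∃ c : Fin I.n, s.reg 16 = c ∧ c ∉ A ∧
      insert c A = I.menBelow (m + 1) := by
    rcases hcases with h | h | h
    · exact h
    · omega
    · omega
  have e₀ : I.womenBase = I.n * I.n + 1 := rfl
  have e₀' : I.rankBase = I.womenBase + I.n * I.n + 1 := rfl
  have e₁ : I.ptrBase = I.rankBase + I.n * I.n := rfl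
  have e₂ : I.bndBase = I.ptrBase + I.n := rfl
  have e₃ : I.stpBase = I.bndBase + I.n := rfl
  have e₄ : I.outBase = I.stpBase + I.n := rfl
  have hnn : I.n ≤ I.n * I.n := Nat.le_mul_self _
  have hpc := hI.ptr_le c
  have hcn := c.isLt
  rcases hpc.eq_or_lt with hp | hp
  · simp only [propose, block_cons, block_nil, add_iff, load_iff, ite_iff, const_iff, move_iff,
      RAMTest.Holds, RAMState.reg_setReg, RAMState.mem_setReg, Nat.reduceEqDiff, if_true, if_false,
      hR.reg_n, hR.reg_ptr, h16, hR.mem_ptr, hp, forall_true_left, not_true_eq_false,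
      IsEmpty.forall_iff, and_true]
    refine ⟨by omega, by omega, by omega, by omega, by omega, 40 * remaining σ.ptr,
      ⟨σ, A, ?_, hI, ?_, ?_⟩, by omega⟩
    · repeat' refine Represents.setReg ?_ _ _ (by decide)
      exact hR
    · simp [RAMState.reg_setReg, h12]
    · right; right
      simp only [RAMState.reg_setReg, Nat.reduceEqDiff, reduceIte, true_and]
      exact fun K N hN => hI.chain_le hcA hp hN
  · obtain ⟨w, hw⟩ : ∃ w, w = I.manList c ⟨σ.ptr c, hp⟩ := ⟨_, rfl⟩
    have hwr : I.manRank c w = σ.ptr c := by rw [hw]; simp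
    have hlw : s.mem (c * I.n + σ.ptr c + 1) = w := by
      rw [hw]; exact hR.mem_men c ⟨σ.ptr c, hp⟩
    have hrk := hR.mem_rank w c trivial
    have i₁ := index_lt c ⟨σ.ptr c, hp⟩
    have i₂ := index_lt w c
    have hwn := w.isLt
    have hb := hI.bnd_le w
    have hst := hI.stp_le w
    have hrn := womanRank_lt w c
    simp only at i₁
    have hrem := remaining_update σ.ptr c hp
    simp only [propose, block_cons, block_nil, add_iff, load_iff, ite_iff, const_iff, move_iff,
      mul_iff, store_iff, RAMTest.Holds, RAMState.reg_setReg, RAMState.mem_setReg,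
      RAMState.reg_setMem, Nat.reduceEqDiff, if_true, if_false, hR.reg_n, hR.reg_one,
      hR.reg_women, hR.reg_rank, hR.reg_bnd, hR.reg_stp, hR.reg_ptr, h16, h12, hR.mem_ptr, hlw,
      hrk, hR.mem_bnd, hR.mem_stp, hp.ne, forall_true_left, not_false_eq_true,
      IsEmpty.forall_iff, true_and]
    refine ⟨by omega, by omega, by omega, by omega, by omega, by omega, by omega, by omega,
      by omega, by omega, by omega, by omega, by omega, by omega, by omega, ?_, ?_⟩
    · intro hlt
      have hacc := fun B hB => hI.accept (B := B) hcA hwr hlt hB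
      refine ⟨fun hs => ?_, fun hs => ?_⟩
      · -- the former suitor `d` of `w` is the next to propose
        have hbn := hI.bnd_lt w hs
        obtain ⟨d, hd⟩ : ∃ d, d = I.womanList w ⟨σ.bnd w, hbn⟩ := ⟨_, rfl⟩
        have hdr : σ.bnd w = I.womanRank w d := by rw [hd]; simp
        have hld : s.mem (w * I.n + I.womenBase + σ.bnd w) = d := by
          rw [hd]; exact hR.mem_women w ⟨σ.bnd w, hbn⟩
        have i₃ := index_lt w ⟨σ.bnd w, hbn⟩
        simp only at i₃
        have hdn := d.isLt
        have hdA : d ∈ A := ((hI.engaged d w).1 ⟨hs, hdr⟩).1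
        have hdc : d ≠ c := fun h => hcA (h ▸ hdA)
        have hstp : Function.update σ.stp w (j + 1) = σ.stp := by
          rw [← hs, Function.update_eq_self]
        rw [hld]
        refine ⟨by omega, by omega, by omega, by omega, by omega,
          40 * remaining (Function.update σ.ptr c (σ.ptr c + 1)) + 40,
          ⟨_, (insert c A).erase d, ?_, hacc _ ?_, ?_, Or.inl ?_⟩, ?_⟩
        · rw [hstp]
          refine Represents.setMem_bnd (Represents.setMem_ptr (σ := σ) ?_ c _) w _
          repeat' refine Represents.setReg ?_ _ _ (by decide)
          exact hR
        · intro x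
          rw [Finset.mem_erase, Finset.mem_insert, hdr, womanRank_inj]
          constructor
          · rintro ⟨h₁, h₂⟩
            exact h₂.imp_right fun h₂ => ⟨h₂, fun h₃ => h₁ h₃.2.symm⟩
          · rintro (rfl | ⟨h₁, h₂⟩)
            · exact ⟨hdc.symm, Or.inl rfl⟩
            · exact ⟨fun h₃ => h₂ ⟨hs, h₃.symm⟩, Or.inr h₁⟩
        · simp [RAMState.reg_setReg, RAMState.reg_setMem, h12]
        · simp only [RAMState.reg_setReg, RAMState.reg_setMem, Nat.reduceEqDiff, reduceIte,
            true_and, h13, h15, h17]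
          refine ⟨d, rfl, Finset.notMem_erase _ _, ?_⟩
          rw [Finset.insert_erase (Finset.mem_insert_of_mem hdA), hA]
        · omega
      · refine ⟨by omega, by omega, by omega, by omega,
          40 * remaining (Function.update σ.ptr c (σ.ptr c + 1)),
          ⟨_, insert c A, ?_, hacc _ ?_, ?_, Or.inr (Or.inl ?_)⟩, ?_⟩
        · refine Represents.setReg ?_ _ _ (by decide)
          refine Represents.setMem_stp (Represents.setMem_bnd
            (Represents.setMem_ptr (σ := σ) ?_ c _) w _) w _
          repeat' refine Represents.setReg ?_ _ _ (by decide)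
          exact hR
        · intro x
          simp [hs]
        · simp [RAMState.reg_setReg, RAMState.reg_setMem, h12]
        · simp only [RAMState.reg_setReg, RAMState.reg_setMem, Nat.reduceEqDiff, reduceIte,
            true_and, h13, h15]
          exact hA
        · omega
    · intro hlt
      refine ⟨by omega, 40 * remaining (Function.update σ.ptr c (σ.ptr c + 1)) + 40,
        ⟨_, A, ?_, hI.reject hcA hwr (not_lt.1 hlt), ?_, Or.inl ?_⟩, ?_⟩
      · refine Represents.setMem_ptr (σ := σ) ?_ c _
        repeat' refine Represents.setReg ?_ _ _ (by decide)
        exact hR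
      · simp [RAMState.reg_setReg, RAMState.reg_setMem, h12]
      · simp only [RAMState.reg_setReg, RAMState.reg_setMem, Nat.reduceEqDiff, reduceIte,
          true_and, h13, h15, h17]
        exact ⟨c, h16, hcA, hA⟩
      · omega

/-- The invariant of the loop of phase `j` over the men, the next of whom is in register `15`. -/
structure MenInvariant (I : SMInstance) (k j : ℕ) (q : Fin I.n → ℕ) (F : List ℕ) (κ : ℕ)
    (s : RAMState) (σ : ProposalState I.n) (A : Finset (Fin I.n)) : Prop where
  rep : I.Represents k (fun _ _ => True) F σ s
  inv : I.PhaseInvariant j q A σ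
  reg_phase : s.reg 12 = j + 1
  cases :
    (s.reg 13 = 0 ∧ s.reg 15 ≤ I.n ∧ A = I.menBelow (s.reg 15) ∧
      κ = 40 * remaining σ.ptr + 60 * (I.n - s.reg 15)) ∨
    (s.reg 13 = 1 ∧ I.n ≤ s.reg 15 ∧ κ = 40 * remaining σ.ptr ∧ ∀ K N, I.IsStableChain K N → K ≤ j)

theorem phase_terminates {W k j : ℕ} (hW : 20 * (2 * (I.n * I.n) + 1) ≤ W) (hj : j ≤ I.n)
    {q : Fin I.n → ℕ} {F : List ℕ} {κ : ℕ} {s : RAMState} {σ : ProposalState I.n}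
    {A : Finset (Fin I.n)} (h : I.MenInvariant k j q F κ s σ A) :
    RAMTerminates W phase s fun t s' => ∃ κ', (∃ σ' A', I.MenInvariant k j q F κ' s' σ' A') ∧
      I.n ≤ s'.reg 15 ∧ t + κ' ≤ κ + 1 := by
  refine (while_of_potential (fun κ s => ∃ σ A, I.MenInvariant k j q F κ s σ A) ?_ κ s
    ⟨σ, A, h⟩).mono ?_
  · clear h σ A κ s
    rintro κ s ⟨σ, A, hR, hI, h12, hcases⟩ hlt
    simp only [RAMTest.Holds, hR.reg_n] at hlt
    obtain ⟨h13, -, hA, hκ⟩ : s.reg 13 = 0 ∧ s.reg 15 ≤ I.n ∧ A = I.menBelow (s.reg 15) ∧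
        κ = 40 * remaining σ.ptr + 60 * (I.n - s.reg 15) := by
      rcases hcases with h | h
      · exact h
      · omega
    have hnn : I.n ≤ I.n * I.n := Nat.le_mul_self _
    simp only [block_cons, move_iff, const_iff]
    refine ⟨by omega, by omega, ?_⟩
    have hinit : I.ProposeInvariant k j (s.reg 15) q F (40 * remaining σ.ptr + 40)
        ((s.setReg 16 (s.reg 15)).setReg 17 1) σ A := by
      refine ⟨?_, hI, ?_, Or.inl ?_⟩
      · repeat' refine Represents.setReg ?_ _ _ (by decide)
        exact hR
      · simp [RAMState.reg_setReg, h12]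
      · simp only [RAMState.reg_setReg, Nat.reduceEqDiff, reduceIte, true_and, h13]
        refine ⟨⟨s.reg 15, hlt⟩, rfl, ?_, ?_⟩
        · simp [hA, menBelow]
        · ext x
          simp only [hA, menBelow, Finset.mem_insert, Finset.mem_filter, Finset.mem_univ, true_and,
            Fin.ext_iff]
          omega
    refine (while_of_potential
      (fun κ s' => ∃ σ A, I.ProposeInvariant k j (s.reg 15) q F κ s' σ A)
      (fun κ' s' ⟨σ', A', h'⟩ hc => propose_terminates hW hj h' ?_) _ _ ⟨σ, A, hinit⟩).mono ?_
    · simpa [RAMTest.Holds, h'.rep.reg_one] using hc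
    · rintro t s' ⟨κ', ⟨σ', A', hR', hI', h12', hcases'⟩, hc, ht⟩
      simp only [RAMTest.Holds, hR'.reg_one] at hc
      simp only [block_nil, add_iff, hR'.reg_one]
      rcases hcases' with h' | ⟨h13', h17', h15', hκ', hA'⟩ | ⟨h13', h17', h15', hκ', hK⟩
      · omega
      · refine ⟨by omega, 40 * remaining σ'.ptr + 60 * (I.n - (s.reg 15 + 1)),
          ⟨σ', A', hR'.setReg _ _ (by decide), hI', ?_, Or.inl ?_⟩, ?_⟩
        · simp [RAMState.reg_setReg, h12']
        · simp only [RAMState.reg_setReg, Nat.reduceEqDiff, reduceIte, h13', h15', true_and]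
          exact ⟨by omega, hA', trivial⟩
        · omega
      · refine ⟨by omega, 40 * remaining σ'.ptr,
          ⟨σ', A', hR'.setReg _ _ (by decide), hI', ?_, Or.inr ?_⟩, ?_⟩
        · simp [RAMState.reg_setReg, h12']
        · simp only [RAMState.reg_setReg, Nat.reduceEqDiff, reduceIte, h13', h15', true_and]
          exact ⟨by omega, hK⟩
        · omega
  · rintro t s' ⟨κ', ⟨σ', A', h'⟩, hc, ht⟩
    refine ⟨κ', ⟨σ', A', h'⟩, ?_, ht⟩
    simpa [RAMTest.Holds, h'.rep.reg_n] using hc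

/-- The words that represent a matching. -/
def matchingWords (μ : Fin I.n → Fin I.n) : List ℕ := (List.finRange I.n).map fun m => (μ m : ℕ)

theorem length_matchingWords (μ : Fin I.n → Fin I.n) : (matchingWords μ).length = I.n := by
  simp [matchingWords]

theorem outputMatching_terminates {W k : ℕ} (hW : 20 * (2 * (I.n * I.n) + 1) ≤ W)
    {F : List ℕ} {s : RAMState} {σ : ProposalState I.n} {μ : Fin I.n → Fin I.n}
    (hF : F.length + I.n ≤ I.n * I.n) (hR : I.Represents k (fun _ _ => True) F σ s)
    (hμ : ∀ m, I.manRank m (μ m) + 1 = σ.ptr m) (h15 : s.reg 15 = 0) :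
    RAMTerminates W outputMatching s fun t s' =>
      I.Represents k (fun _ _ => True) (F ++ matchingWords μ) σ s' ∧ s'.reg 12 = s.reg 12 ∧
        s'.reg 13 = s.reg 13 ∧ t ≤ 10 * I.n + 1 := by
  have e₀ : I.womenBase = I.n * I.n + 1 := rfl
  have e₀' : I.rankBase = I.womenBase + I.n * I.n + 1 := rfl
  have e₁ : I.ptrBase = I.rankBase + I.n * I.n := rfl
  have e₂ : I.bndBase = I.ptrBase + I.n := rfl
  have e₃ : I.stpBase = I.bndBase + I.n := rfl
  have e₄ : I.outBase = I.stpBase + I.n := rfl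
  have hnn : I.n ≤ I.n * I.n := Nat.le_mul_self _
  have hlen := length_matchingWords μ
  refine (while_of_potential (fun κ s' => s'.reg 15 ≤ I.n ∧ κ = 10 * (I.n - s'.reg 15) ∧
    I.Represents k (fun _ _ => True) (F ++ (matchingWords μ).take (s'.reg 15)) σ s' ∧
    s'.reg 12 = s.reg 12 ∧ s'.reg 13 = s.reg 13) ?_ (10 * I.n) s ?_).mono ?_
  · rintro κ s' ⟨hle, hκ, hR', h12, h13⟩ hlt
    simp only [RAMTest.Holds, hR'.reg_n] at hlt
    obtain ⟨m, hm⟩ : ∃ m : Fin I.n, s'.reg 15 = m := ⟨⟨_, hlt⟩, rfl⟩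
    rw [hm] at hR' hκ hlt
    have hmem : s'.mem (m * I.n + σ.ptr m) = μ m := by
      have := hR'.mem_men m ((I.manList m).symm (μ m))
      rw [Equiv.apply_symm_apply] at this
      rw [← this, ← hμ m]
      rfl
    have i₁ := index_lt m ((I.manList m).symm (μ m))
    have hp : ((I.manList m).symm (μ m) : ℕ) + 1 = σ.ptr m := hμ m
    have hμn := (μ m).isLt
    have hl : (F ++ (matchingWords μ).take m).length = F.length + m := by
      simp [hlen, m.isLt.le]
    have hnext := hR'.reg_next
    simp only [block_cons, block_nil, add_iff, load_iff, mul_iff, store_iff, RAMState.reg_setReg,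
      RAMState.mem_setReg, RAMState.reg_setMem, Nat.reduceEqDiff, reduceIte, hm, hR'.reg_n,
      hR'.reg_one, hR'.reg_ptr, hR'.mem_ptr, hmem, hnext]
    refine ⟨by omega, by omega, by omega, by omega, by omega, by omega, by omega, by omega, _,
      ⟨?_, rfl, ?_, ?_, ?_⟩, ?_⟩
    · omega
    · have htake : (matchingWords μ).take (m + 1) = (matchingWords μ).take m ++ [(μ m : ℕ)] := by
        rw [List.take_add_one, List.getElem?_eq_getElem (by omega)]
        simp [matchingWords]
      rw [htake, ← List.append_assoc]
      refine Represents.setReg ?_ _ _ (by decide)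
      refine Represents.append_out (σ := σ) ?_ _
      repeat' refine Represents.setReg ?_ _ _ (by decide)
      exact hR'
    · exact h12
    · exact h13
    · omega
  · simpa [h15] using hR
  · rintro t s' ⟨κ', ⟨hle, hκ, hR', h12, h13⟩, hc, ht⟩
    simp only [RAMTest.Holds, hR'.reg_n] at hc
    rw [List.take_of_length_le (by omega)] at hR'
    exact ⟨hR', h12, h13, by omega⟩

end SMInstance

namespace SMInstance

/-! ### The loop of phases and the table of rankings -/

open RAMTerminates StableMatchingProgram

variable {I : SMInstance}

/-- The words that represent a list of matchings. -/
def listWords (L : List (Fin I.n → Fin I.n)) : List ℕ := L.flatMap matchingWords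

theorem length_listWords (L : List (Fin I.n → Fin I.n)) :
    (listWords L).length = L.length * I.n := by
  induction L with
  | nil => simp [listWords]
  | cons μ L ih =>
    have : listWords (μ :: L) = matchingWords μ ++ listWords L := rfl
    rw [this, List.length_append, ih, length_matchingWords, List.length_cons]
    ring

theorem listWords_append (L : List (Fin I.n → Fin I.n)) (μ : Fin I.n → Fin I.n) :
    listWords (L ++ [μ]) = listWords L ++ matchingWords μ := by
  simp [listWords]

/-- The invariant of the loop of phases: either all matchings found so far are in `L` and the next
phase can start, or `L` is complete. The potential pays for at most `n + 1 - L.length` further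
phases, apart from the proposals. -/
structure PhasesInvariant (I : SMInstance) (k κ : ℕ) (s : RAMState) (σ : ProposalState I.n)
    (L : List (Fin I.n → Fin I.n)) : Prop where
  rep : I.Represents k (fun _ _ => True) (listWords L) σ s
  reg_phase : s.reg 12 = L.length + 1
  cases :
    (s.reg 13 = 0 ∧ I.PhaseHistory L σ.ptr ∧ I.PhaseInvariant L.length σ.ptr ∅ σ ∧
      κ = 40 * remaining σ.ptr + (I.n + 1 - L.length) * (80 * I.n + 100)) ∨
    (s.reg 13 = 1 ∧ I.IsSolution L ∧ κ = 0)

theorem phases_terminates {W k : ℕ} (hW : 20 * (2 * (I.n * I.n) + 1) ≤ W) (hn : 0 < I.n)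
    {κ : ℕ} {s : RAMState} {σ : ProposalState I.n} {L : List (Fin I.n → Fin I.n)}
    (h : I.PhasesInvariant k κ s σ L) :
    RAMTerminates W phases s fun t s' => t ≤ κ + 1 ∧ ∃ σ' L',
      I.Represents k (fun _ _ => True) (listWords L') σ' s' ∧ s'.reg 12 = L'.length + 1 ∧
        I.IsSolution L' := by
  refine (while_of_potential (fun κ s => ∃ σ L, I.PhasesInvariant k κ s σ L) ?_ κ s
    ⟨σ, L, h⟩).mono ?_
  · clear h L σ s κ
    rintro κ s ⟨σ, L, hR, h12, hcases⟩ hc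
    simp only [RAMTest.Holds, hR.reg_zero] at hc
    obtain ⟨-, hH, hI, hκ⟩ : s.reg 13 = 0 ∧ I.PhaseHistory L σ.ptr ∧
        I.PhaseInvariant L.length σ.ptr ∅ σ ∧
        κ = 40 * remaining σ.ptr + (I.n + 1 - L.length) * (80 * I.n + 100) := by
      rcases hcases with h | h
      · exact h
      · omega
    have hnn : I.n ≤ I.n * I.n := Nat.le_mul_self _
    have hLn : L.length ≤ I.n := (hH.length_le ⟨0, hn⟩).trans (hI.ptr_le _)
    obtain ⟨d, hd⟩ : ∃ d, I.n + 1 - L.length = d + 1 := ⟨I.n - L.length, by omega⟩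
    rw [hd, add_mul, one_mul] at hκ
    simp only [block_cons, const_iff]
    refine ⟨by omega, ?_⟩
    have hinit : I.MenInvariant k L.length σ.ptr (listWords L)
        (40 * remaining σ.ptr + 60 * (I.n - 0)) (s.setReg 15 0) σ ∅ := by
      refine ⟨hR.setReg _ _ (by decide), hI, ?_, Or.inl ?_⟩
      · simp [RAMState.reg_setReg, h12]
      · simp [RAMState.reg_setReg, hc, menBelow]
    refine (phase_terminates hW hLn hinit).mono ?_
    rintro t s' ⟨κ', ⟨σ', A', hR', hI', h12', hcases'⟩, h15', ht⟩
    simp only [block_nil, ite_iff, block_cons, const_iff, RAMTest.Holds, hR'.reg_zero, skip_iff]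
    rcases hcases' with ⟨h13', hle, hA', hκ'⟩ | ⟨h13', -, hκ', hK⟩
    · refine ⟨fun _ => ?_, fun h => absurd h13' h⟩
      have hA : A' = Finset.univ := by
        ext x
        have := x.isLt
        simp only [hA', menBelow, Finset.mem_filter, Finset.mem_univ, true_and, iff_true]
        omega
      rw [hA] at hI'
      have hlt := hI'.start_lt
      obtain ⟨μ, hμ⟩ : ∃ μ : Fin I.n → Fin I.n, ∀ m, I.manRank m (μ m) + 1 = σ'.ptr m := by
        refine ⟨fun m => I.manList m ⟨σ'.ptr m - 1, ?_⟩, fun m => ?_⟩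
        · have h₁ := hlt m (Finset.mem_univ m)
          have h₂ := hI'.ptr_le m
          omega
        · have h₁ := hlt m (Finset.mem_univ m)
          rw [manRank_manList]
          simp only
          omega
      have hlen : L.length + 1 ≤ I.n := by
        have h₁ := hlt ⟨0, hn⟩ (Finset.mem_univ _)
        have h₂ := hI'.ptr_le ⟨0, hn⟩
        have h₃ := hH.length_le ⟨0, hn⟩
        omega
      have hF : (listWords L).length + I.n ≤ I.n * I.n := by
        rw [length_listWords]
        calc L.length * I.n + I.n = (L.length + 1) * I.n := by ring
          _ ≤ I.n * I.n := Nat.mul_le_mul_right _ hlen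
      refine ⟨by omega, ?_⟩
      refine (outputMatching_terminates hW hF (hR'.setReg 15 0 (by decide)) hμ
        (by simp [RAMState.reg_setReg])).mono ?_
      rintro t' s'' ⟨hR'', h12'', h13'', ht'⟩
      simp only [RAMState.reg_setReg, Nat.reduceEqDiff, reduceIte, h12', h13'] at h12'' h13''
      simp only [add_iff, h12'', hR''.reg_one]
      have hd' : I.n + 1 - (L ++ [μ]).length = d := by
        simp only [List.length_append, List.length_singleton]
        omega
      refine ⟨by omega, 40 * remaining σ'.ptr + d * (80 * I.n + 100),
        ⟨σ', L ++ [μ], ?_, ?_, Or.inl ⟨?_, hH.append hI' hμ, ?_, ?_⟩⟩, ?_⟩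
      · rw [listWords_append]
        exact hR''.setReg _ _ (by decide)
      · simp [RAMState.reg_setReg]
      · simp [RAMState.reg_setReg, h13'']
      · rw [List.length_append]
        exact hI'.next_phase
      · rw [hd']
      · omega
    · refine ⟨fun h => by omega, fun _ => ⟨0, ⟨σ', L, hR', h12', Or.inr ⟨h13', ?_, rfl⟩⟩, ?_⟩⟩
      · exact hH.isSolution hn hK
      · have := Nat.zero_le (d * (80 * I.n + 100))
        omega
  · rintro t s' ⟨κ', ⟨σ', L', hR', h12', hcases'⟩, hc, ht⟩
    simp only [RAMTest.Holds, hR'.reg_zero] at hc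
    rcases hcases' with h' | h'
    · exact absurd h'.1 hc
    · exact ⟨by omega, σ', L', hR', h12', h'.2.1⟩

theorem rankRow_terminates {W k : ℕ} (hW : 20 * (2 * (I.n * I.n) + 1) ≤ W)
    {s : RAMState} {σ : ProposalState I.n} (w : Fin I.n)
    (hR : I.Represents k (fun x _ => x < w) [] σ s) (h15 : s.reg 15 = w)
    (h17 : s.reg 17 = 0) (h22 : s.reg 22 = w * I.n) :
    RAMTerminates W rankRow s fun t s' => I.Represents k (fun x _ => x ≤ w) [] σ s' ∧
      s'.reg 15 = w ∧ t ≤ 10 * I.n + 1 := by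
  have e₀ : I.womenBase = I.n * I.n + 1 := rfl
  have e₀' : I.rankBase = I.womenBase + I.n * I.n + 1 := rfl
  refine (while_of_potential (fun κ s' => s'.reg 17 ≤ I.n ∧ κ = 10 * (I.n - s'.reg 17) ∧
    I.Represents k (fun x y => x < w ∨ x = w ∧ I.womanRank w y < s'.reg 17) [] σ s' ∧
    s'.reg 15 = w ∧ s'.reg 22 = w * I.n) ?_ (10 * I.n) s ?_).mono ?_
  · rintro κ s' ⟨hle, hκ, hR', h15, h22⟩ hlt
    simp only [RAMTest.Holds, hR'.reg_n] at hlt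
    obtain ⟨i, hi⟩ : ∃ i : Fin I.n, s'.reg 17 = i := ⟨⟨_, hlt⟩, rfl⟩
    rw [hi] at hR' hκ hlt
    have hmem := hR'.mem_women w i
    have i₁ := index_lt w i
    have i₂ := index_lt w (I.womanList w i)
    have hm := (I.womanList w i).isLt
    have hnn : I.n ≤ I.n * I.n := Nat.le_mul_self _
    simp only [block_cons, block_nil, add_iff, load_iff, store_iff, RAMState.reg_setReg,
      RAMState.mem_setReg, RAMState.reg_setMem, Nat.reduceEqDiff, reduceIte, hi, h22,
      hR'.reg_one, hR'.reg_women, hR'.reg_rank, hmem]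
    refine ⟨by omega, by omega, by omega, by omega, by omega, by omega, by omega, _,
      ⟨?_, rfl, ?_, h15, trivial⟩, ?_⟩
    · omega
    · refine Represents.setReg ?_ _ _ (by decide)
      have hset := fun s hs => Represents.setMem_rank (I := I) (k := k) (F := []) (σ := σ) (s := s)
        (D := fun x y => x < w ∨ x = w ∧ I.womanRank w y < i) hs w (I.womanList w i)
        (D' := fun x y => x < w ∨ x = w ∧ I.womanRank w y < i + 1) ?_
      · rw [womanRank_womanList] at hset
        refine hset _ ?_
        repeat' refine Represents.setReg ?_ _ _ (by decide)
        exact hR'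
      · rintro x y (h | ⟨rfl, h⟩)
        · exact Or.inl (Or.inl h)
        · rcases (Nat.lt_succ_iff_lt_or_eq.1 h) with h | h
          · exact Or.inl (Or.inr ⟨rfl, h⟩)
          · exact Or.inr ⟨rfl, womanRank_inj.1 (h.trans (womanRank_womanList x i).symm)⟩
    · omega
  · simpa [h17, h15, h22] using hR
  · rintro t s' ⟨κ', ⟨hle, hκ, hR', h15, h22⟩, hc, ht⟩
    simp only [RAMTest.Holds, hR'.reg_n] at hc
    have hD : (fun x y => x < w ∨ x = w ∧ I.womanRank w y < s'.reg 17) =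
        fun x _ => x ≤ w := by
      funext x y
      have := womanRank_lt w y
      rw [le_iff_lt_or_eq]
      have h : I.womanRank w y < s'.reg 17 := by omega
      simp [h]
    rw [hD] at hR'
    exact ⟨hR', h15, by omega⟩

/-- The data before the first proposal, except that `bnd` is set for the women below `w` only. -/
def initialState (n w : ℕ) : ProposalState n where
  ptr _ := 0
  bnd x := if x.1 < w then n else 0
  stp _ := 0

theorem rankTable_terminates {W k : ℕ} (hW : 20 * (2 * (I.n * I.n) + 1) ≤ W)
    {s : RAMState} (hR : I.Represents k (fun _ _ => False) [] (initialState I.n 0) s)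
    (h15 : s.reg 15 = 0) :
    RAMTerminates W rankTable s fun t s' =>
      I.Represents k (fun _ _ => True) [] (initialState I.n I.n) s' ∧
      t ≤ I.n * (10 * I.n + 10) + 1 := by
  have e₀ : I.womenBase = I.n * I.n + 1 := rfl
  have e₀' : I.rankBase = I.womenBase + I.n * I.n + 1 := rfl
  have e₁ : I.ptrBase = I.rankBase + I.n * I.n := rfl
  have e₂ : I.bndBase = I.ptrBase + I.n := rfl
  have hnn : I.n ≤ I.n * I.n := Nat.le_mul_self _
  refine (while_of_potential (fun κ s' => s'.reg 15 ≤ I.n ∧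
    κ = (I.n - s'.reg 15) * (10 * I.n + 10) ∧
    I.Represents k (fun x _ => x < s'.reg 15) [] (initialState I.n (s'.reg 15)) s') ?_
    (I.n * (10 * I.n + 10)) s ?_).mono ?_
  · rintro κ s' ⟨hle, hκ, hR'⟩ hlt
    simp only [RAMTest.Holds, hR'.reg_n] at hlt
    obtain ⟨w, hw⟩ : ∃ w : Fin I.n, s'.reg 15 = w := ⟨⟨_, hlt⟩, rfl⟩
    rw [hw] at hR' hκ hlt
    obtain ⟨d, hd⟩ : ∃ d, I.n - w = d + 1 := ⟨I.n - w - 1, by omega⟩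
    rw [hd, add_mul, one_mul] at hκ
    have i₁ := index_lt w w
    simp only [block_cons, block_nil, add_iff, mul_iff, const_iff, store_iff, RAMState.reg_setReg,
      RAMState.reg_setMem, Nat.reduceEqDiff, reduceIte, hw, hR'.reg_n, hR'.reg_bnd]
    refine ⟨by omega, by omega, by omega, by omega, ?_⟩
    refine (rankRow_terminates (k := k) hW w (σ := initialState I.n (w + 1)) ?_ ?_ ?_ ?_).mono ?_
    · refine Represents.setReg (Represents.setReg ?_ _ _ (by decide)) _ _ (by decide)
      have hset := Represents.setMem_bnd (hR'.setReg 25 (I.bndBase + w) (by decide)) w I.n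
      have hσ : initialState I.n (w + 1) = { initialState I.n w with
          bnd := Function.update (initialState I.n w).bnd w I.n } := by
        refine ProposalState.ext rfl (funext fun x => ?_) rfl
        simp only [initialState, Function.update_apply, Fin.ext_iff]
        split_ifs <;> omega
      rw [hσ]
      exact hset
    · simpa [RAMState.reg_setReg, RAMState.reg_setMem] using hw
    · simp [RAMState.reg_setReg]
    · simp [RAMState.reg_setReg]
    · rintro t s'' ⟨hR'', h15'', ht⟩
      simp only [h15'', hR''.reg_one]
      refine ⟨by omega, _, ⟨?_, rfl, ?_⟩, ?_⟩
      · omega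
      · convert hR''.setReg 15 (w + 1) (by decide) using 3 with x
        rw [Fin.le_def]
        omega
      · have : I.n - (w + 1) = d := by omega
        rw [this]
        omega
  · simpa [h15] using hR
  · rintro t s' ⟨κ', ⟨hle, hκ, hR'⟩, hc, ht⟩
    simp only [RAMTest.Holds, hR'.reg_n] at hc
    have h15' : s'.reg 15 = I.n := by omega
    rw [h15'] at hR'
    refine ⟨?_, by omega⟩
    simpa using hR'

end SMInstance

namespace SMInstance

open RAMTerminates StableMatchingProgram

variable {I : SMInstance}

/-! ### Input and output -/

theorem getD_flatMap_append {α : Type*} {n : ℕ} (f : α → List ℕ) (hf : ∀ a, (f a).length = n)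
    (l : List α) (r : List ℕ) (j : ℕ) (hj : j < l.length) {i : ℕ} (hi : i < n) :
    (l.flatMap f ++ r).getD (j * n + i) 0 = (f l[j]).getD i 0 := by
  induction l generalizing j with
  | nil => simp at hj
  | cons a l ih =>
    rw [List.flatMap_cons, List.append_assoc]
    cases j with
    | zero =>
      rw [List.getD_append _ _ _ _ (by rw [hf]; omega)]
      simp
    | succ j =>
      have hle : n ≤ (j + 1) * n + i := by rw [add_mul, one_mul]; omega
      rw [List.getD_append_right _ _ _ _ (by rw [hf]; exact hle), hf]
      have : (j + 1) * n + i - n = j * n + i := by rw [add_mul, one_mul]; omega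
      rw [this, ih j (by simpa using hj)]
      simp

theorem length_flatMap_finRange (f : Fin I.n → Fin I.n → Fin I.n) :
    ((List.finRange I.n).flatMap fun m => (List.finRange I.n).map fun i => (f m i : ℕ)).length =
      I.n * I.n := by
  simp [List.length_flatMap]

theorem length_encode : I.encode.length = 2 * (I.n * I.n) + 1 := by
  rw [encode, List.length_cons, List.length_append, length_flatMap_finRange,
    length_flatMap_finRange]
  ring

theorem getD_lists_append (f : Fin I.n → Fin I.n → Fin I.n) (r : List ℕ) (m i : Fin I.n) :
    (((List.finRange I.n).flatMap fun m => (List.finRange I.n).map fun i => (f m i : ℕ)) ++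
      r).getD (m * I.n + i) 0 = f m i := by
  rw [getD_flatMap_append _ (by simp) _ _ _ (by simp) i.isLt]
  simp

variable (I) in
/-- The initial state with the further input word `k`. -/
def startState (k : ℕ) : RAMState := RAMState.start (I.encode ++ [k])

/-- Missing words are zero, so that the input without `k` gives the same state as `k = 0`. -/
theorem start_encode : RAMState.start I.encode = I.startState 0 := by
  unfold startState RAMState.start
  congr 1
  funext a
  by_cases ha : a < I.encode.length
  · rw [List.getD_append _ _ _ _ ha]
  · rw [List.getD_append_right _ _ _ _ (by omega), List.getD_eq_default _ _ (by omega)]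
    cases a - I.encode.length <;> simp

theorem startState_mem_zero (k : ℕ) : (I.startState k).mem 0 = I.n := rfl

theorem startState_mem_men (k : ℕ) (m i : Fin I.n) :
    (I.startState k).mem (m * I.n + i + 1) = I.manList m i := by
  unfold startState RAMState.start encode
  simp only [List.cons_append, List.getD_cons_succ, List.append_assoc]
  exact getD_lists_append (fun m i => I.manList m i) _ m i

theorem startState_mem_women (k : ℕ) (w i : Fin I.n) :
    (I.startState k).mem (w * I.n + I.womenBase + i) = I.womanList w i := by
  have : (w * I.n + I.womenBase + i : ℕ) = (w * I.n + i + I.n * I.n) + 1 := by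
    unfold womenBase; ring
  rw [this]
  unfold startState RAMState.start encode
  simp only [List.cons_append, List.getD_cons_succ, List.append_assoc]
  have hlen := length_flatMap_finRange (fun m i => I.manList m i)
  rw [List.getD_append_right _ _ _ _ (by rw [hlen]; omega), hlen, Nat.add_sub_cancel]
  exact getD_lists_append (fun m i => I.womanList m i) _ w i

theorem startState_mem_k (k : ℕ) : (I.startState k).mem (I.rankBase - 1) = k := by
  have : I.rankBase - 1 = I.encode.length := by
    rw [length_encode]
    unfold rankBase womenBase
    omega
  unfold startState RAMState.start
  simp only [this]
  rw [List.getD_append_right _ _ _ _ le_rfl]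
  simp

theorem startState_mem_of_le (k : ℕ) {a : ℕ} (ha : I.rankBase ≤ a) :
    (I.startState k).mem a = 0 := by
  unfold startState RAMState.start
  refine List.getD_eq_default _ _ ?_
  rw [List.length_append, length_encode]
  unfold rankBase womenBase at ha
  simp only [List.length_singleton]
  omega

theorem layout_terminates {W : ℕ} (hW : 20 * (2 * (I.n * I.n) + 1) ≤ W) (k : ℕ) :
    RAMTerminates W layout (I.startState k) fun t s' =>
      I.Represents k (fun _ _ => False) [] (initialState I.n 0) s' ∧ s'.reg 15 = 0 ∧ t ≤ 13 := by
  have e₀ : I.womenBase = I.n * I.n + 1 := rfl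
  have e₀' : I.rankBase = I.womenBase + I.n * I.n + 1 := rfl
  have e₁ : I.ptrBase = I.rankBase + I.n * I.n := rfl
  have e₂ : I.bndBase = I.ptrBase + I.n := rfl
  have e₃ : I.stpBase = I.bndBase + I.n := rfl
  have e₄ : I.outBase = I.stpBase + I.n := rfl
  have hnn : I.n ≤ I.n * I.n := Nat.le_mul_self _
  have hreg : ∀ r, (I.startState k).reg r = 0 := fun r => rfl
  have hzero := fun a => startState_mem_of_le (I := I) k (a := a)
  simp only [layout, block_cons, block_nil, load_iff, const_iff, add_iff, mul_iff,
    RAMState.reg_setReg, Nat.reduceEqDiff, reduceIte, hreg, startState_mem_zero]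
  refine ⟨by omega, by omega, by omega, by omega, by omega, by omega, by omega, by omega,
    by omega, by omega, by omega, by omega, ?_, trivial, by omega⟩
  constructor <;> simp only [RAMState.reg_setReg, Nat.reduceEqDiff, reduceIte, hreg,
    RAMState.mem_setReg, startState_mem_men, startState_mem_women, startState_mem_k,
    List.length_nil, add_zero, implies_true, initialState, false_imp_iff, not_lt_zero]
  case reg_women => omega
  case reg_rank => omega
  case reg_ptr => omega
  case reg_bnd => omega
  case reg_stp => omega
  case reg_out => omega
  case reg_next => omega
  case mem_ptr => exact fun m => hzero _ (by omega)
  case mem_bnd => exact fun m => hzero _ (by omega)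
  case mem_stp => exact fun m => hzero _ (by omega)
  case mem_out => exact fun i hi => hi.elim

theorem core_terminates {W : ℕ} (hW : 20 * (2 * (I.n * I.n) + 1) ≤ W) (k : ℕ) :
    RAMTerminates W core (I.startState k) fun t s' => t ≤ 400 * (2 * (I.n * I.n) + 1) ∧
      ∃ σ L, I.Represents k (fun _ _ => True) (listWords L) σ s' ∧ s'.reg 12 = L.length + 1 ∧
        I.IsSolution L := by
  have hnn : I.n ≤ I.n * I.n := Nat.le_mul_self _
  simp only [core, block_cons]
  refine (layout_terminates hW k).mono ?_
  rintro t₁ s₁ ⟨hR₁, h15, ht₁⟩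
  refine (rankTable_terminates hW hR₁ h15).mono ?_
  rintro t₂ s₂ ⟨hR₂, ht₂⟩
  have hPI := PhaseInvariant.init (I := I)
  have hσ : initialState I.n I.n = ⟨fun _ => 0, fun _ => I.n, fun _ => 0⟩ := by
    simp [initialState]
  rw [← hσ] at hPI
  simp only [const_iff, block_nil, ite_iff, RAMTest.Holds, RAMState.reg_setReg, Nat.reduceEqDiff,
    reduceIte, hR₂.reg_n, hR₂.reg_zero]
  have hring : I.n * (10 * I.n + 10) = 10 * (I.n * I.n) + 10 * I.n := by ring
  refine ⟨by omega, by omega,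
    fun hn => ⟨by omega, by omega, initialState I.n I.n, [id], ?_, ?_, ?_⟩, fun hn => ?_⟩
  · have hnil : listWords [(id : Fin I.n → Fin I.n)] = [] := by
      rw [← List.length_eq_zero_iff, length_listWords, hn, mul_zero]
    rw [hnil]
    repeat' refine Represents.setReg ?_ _ _ (by decide)
    exact hR₂
  · rfl
  · exact isSolution_of_n_eq_zero hn _
  · refine (phases_terminates (k := k) (σ := initialState I.n I.n) (L := []) hW
      (Nat.pos_of_ne_zero hn) ⟨?_, ?_, Or.inl ⟨?_, ⟨?_, ?_, ?_, ?_⟩, hPI, rfl⟩⟩).mono ?_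
    · refine Represents.setReg (Represents.setReg ?_ _ _ (by decide)) _ _ (by decide)
      exact hR₂
    · simp [RAMState.reg_setReg]
    · simp [RAMState.reg_setReg]
    · simp
    · simp
    · simp
    · simp
    · -- `40` steps for each of the `n ^ 2` proposals and `80 * n + 100` for each of `n + 1` phases
      rintro t₃ s₃ ⟨ht₃, σ, L, hL⟩
      refine ⟨?_, σ, L, hL⟩
      have hrem : remaining (initialState I.n I.n).ptr = I.n * I.n := by
        simp [remaining, initialState]
      have hring' : (I.n + 1 - 0) * (80 * I.n + 100) =
          80 * (I.n * I.n) + 180 * I.n + 100 := by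
        rw [Nat.sub_zero]; ring
      rw [List.length_nil, hrem, hring'] at ht₃
      omega

theorem storeCount_terminates {W k : ℕ} (hW : 20 * (2 * (I.n * I.n) + 1) ≤ W) {s : RAMState}
    {σ : ProposalState I.n} {L : List (Fin I.n → Fin I.n)} (hLn : L.length ≤ I.n + 1)
    (hR : I.Represents k (fun _ _ => True) (listWords L) σ s) (h12 : s.reg 12 = L.length + 1) :
    RAMTerminates W storeCount s fun t s' => t ≤ 4 ∧ s'.reg 18 = I.outBase + 1 ∧
      s'.reg 19 = L.length ∧ (∀ r < 12, s'.reg r = s.reg r) ∧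
      s'.mem (I.rankBase - 1) = k ∧ s'.mem (I.outBase + 1) = L.length ∧
      ∀ (i : ℕ) (h : i < (listWords L).length),
        s'.mem (I.outBase + 2 + i) = (listWords L)[i] := by
  have e₀ : I.womenBase = I.n * I.n + 1 := rfl
  have e₀' : I.rankBase = I.womenBase + I.n * I.n + 1 := rfl
  have e₁ : I.ptrBase = I.rankBase + I.n * I.n := rfl
  have e₂ : I.bndBase = I.ptrBase + I.n := rfl
  have e₃ : I.stpBase = I.bndBase + I.n := rfl
  have e₄ : I.outBase = I.stpBase + I.n := rfl
  have hnn : I.n ≤ I.n * I.n := Nat.le_mul_self _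
  simp only [storeCount, block_cons, block_nil, sub_iff, add_iff, store_iff, RAMState.reg_setReg,
    RAMState.reg_setMem, Nat.reduceEqDiff, reduceIte, h12, hR.reg_one, hR.reg_out]
  refine ⟨by omega, by omega, by omega, by omega, trivial, by omega, ?_, ?_, ?_, ?_⟩
  · intro r hr
    rw [if_neg (by omega), if_neg (by omega)]
  · rw [RAMState.mem_setMem, if_neg (by omega)]
    exact hR.mem_k
  · rw [RAMState.mem_setMem, if_pos rfl, Nat.add_sub_cancel]
  · intro i hi
    rw [RAMState.mem_setMem, if_neg (by omega)]
    exact hR.mem_out i hi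

/-- A collection has at most `n` members, or `1` if `n = 0`, since the partners of the man `0` are
distinct. The bound is needed for the size of the words. -/
theorem IsSolution.length_le {L : List (Fin I.n → Fin I.n)} (hL : I.IsSolution L) :
    L.length ≤ I.n + 1 := by
  rcases Nat.eq_zero_or_pos I.n with hn | hn
  · have := hL.1.length_le_card
    simp only [Fintype.card_pi_const, Fintype.card_fin, hn, pow_zero] at this
    omega
  · have hnd : (L.map fun μ => μ ⟨0, hn⟩).Nodup := by
      refine List.Nodup.map_on (fun μ hμ ν hν h => ?_) hL.1
      by_contra hne
      have hdis := hL.2.1.2 (I.edgesOf μ) (by simpa using ⟨μ, hμ, rfl⟩) (I.edgesOf ν)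
        (by simpa using ⟨ν, hν, rfl⟩) (fun h => hne (edgesOf_injective h))
      exact Finset.disjoint_left.1 hdis (mem_edgesOf.2 rfl) (mem_edgesOf.2 h.symm)
    have := hnd.length_le_card
    rw [List.length_map, Fintype.card_fin] at this
    omega

theorem IsSolution.length_listWords_le {L : List (Fin I.n → Fin I.n)} (hL : I.IsSolution L) :
    (listWords L).length ≤ 2 * (I.n * I.n) := by
  rw [length_listWords]
  calc L.length * I.n ≤ (I.n + 1) * I.n := Nat.mul_le_mul_right _ hL.length_le
    _ = I.n * I.n + I.n := by ring
    _ ≤ 2 * (I.n * I.n) := by have := Nat.le_mul_self I.n; omega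

theorem lists_listWords {L : List (Fin I.n → Fin I.n)} (hL : L.Nodup) :
    I.Lists (L.length :: listWords L) (L.map I.edgesOf).toFinset := ⟨L, hL, rfl, rfl⟩

theorem output_eq {s : RAMState} {y : List ℕ} (h₁ : s.reg 1 = y.length)
    (h : ∀ (i : ℕ) (hi : i < y.length), s.mem (s.reg 0 + i) = y[i]) : s.output = y := by
  refine List.ext_getElem (by simp [RAMState.output, h₁]) fun i hi hi' => ?_
  simp [RAMState.output, h i hi']

theorem findLargest_terminates {W : ℕ} (hW : 20 * (2 * (I.n * I.n) + 1) ≤ W) :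
    RAMTerminates W findLargest (I.startState 0) fun t s =>
      t ≤ 500 * (2 * (I.n * I.n) + 1) ∧
      ∃ S, I.Lists s.output S ∧ I.IsLargestDisjointStable S := by
  simp only [findLargest, block_cons]
  refine (core_terminates hW 0).mono ?_
  rintro t₁ s₁ ⟨ht₁, σ, L, hR, h12, hL⟩
  refine (storeCount_terminates hW hL.length_le hR h12).mono ?_
  rintro t₂ s₂ ⟨ht₂, h18, h19, hreg, -, hcount, hout⟩
  have hlen := hL.length_listWords_le
  have hnn : I.n ≤ I.n * I.n := Nat.le_mul_self _
  have e₀ : I.womenBase = I.n * I.n + 1 := rfl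
  have e₀' : I.rankBase = I.womenBase + I.n * I.n + 1 := rfl
  have e₁ : I.ptrBase = I.rankBase + I.n * I.n := rfl
  have e₂ : I.bndBase = I.ptrBase + I.n := rfl
  have e₃ : I.stpBase = I.bndBase + I.n := rfl
  have e₄ : I.outBase = I.stpBase + I.n := rfl
  simp only [move_iff, sub_iff, block_nil, RAMState.reg_setReg, Nat.reduceEqDiff, reduceIte, h18,
    hreg 11 (by decide), hR.reg_next]
  refine ⟨by omega, by omega, by omega, (L.map I.edgesOf).toFinset, ?_, hL.2⟩
  rw [output_eq (y := L.length :: listWords L)]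
  · exact lists_listWords hL.1
  · simp only [RAMState.reg_setReg, Nat.reduceEqDiff, reduceIte, List.length_cons]
    omega
  · intro i hi
    simp only [RAMState.reg_setReg, Nat.reduceEqDiff, reduceIte, RAMState.mem_setReg]
    cases i with
    | zero => exact hcount
    | succ i =>
      have : I.outBase + 1 + (i + 1) = I.outBase + 2 + i := by omega
      rw [this]
      exact hout i (by simpa using hi)

theorem decideCount_terminates {W k : ℕ} (hW : 20 * (2 * (I.n * I.n) + 1) ≤ W) (hk : k ≤ W) :
    RAMTerminates W decideCount (I.startState k) fun t s =>
      t ≤ 500 * (2 * (I.n * I.n) + 1) ∧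
      ((∃ y S, s.output = 1 :: y ∧ I.Lists y S ∧ I.IsDisjointStable S ∧ k ≤ S.card) ∨
        (s.output = [0] ∧ ¬ ∃ S, I.IsDisjointStable S ∧ k ≤ S.card)) := by
  simp only [decideCount, block_cons]
  refine (core_terminates hW k).mono ?_
  rintro t₁ s₁ ⟨ht₁, σ, L, hR, h12, hL⟩
  refine (storeCount_terminates hW hL.length_le hR h12).mono ?_
  rintro t₂ s₂ ⟨ht₂, h18, h19, hreg, hmemk, hcount, hout⟩
  have hlen := hL.length_listWords_le
  have hcard := card_edgesOf_toFinset hL.1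
  have hnn : I.n ≤ I.n * I.n := Nat.le_mul_self _
  have e₀ : I.womenBase = I.n * I.n + 1 := rfl
  have e₀' : I.rankBase = I.womenBase + I.n * I.n + 1 := rfl
  have e₁ : I.ptrBase = I.rankBase + I.n * I.n := rfl
  have e₂ : I.bndBase = I.ptrBase + I.n := rfl
  have e₃ : I.stpBase = I.bndBase + I.n := rfl
  have e₄ : I.outBase = I.stpBase + I.n := rfl
  simp only [move_iff, sub_iff, load_iff, store_iff, const_iff, ite_iff, block_nil, block_cons,
    RAMTest.Holds, RAMState.reg_setReg, RAMState.mem_setReg, RAMState.reg_setMem,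
    Nat.reduceEqDiff, reduceIte, h19, hmemk, hreg 11 (by decide), hreg 10 (by decide),
    hreg 6 (by decide), hreg 4 (by decide), hreg 3 (by decide), hR.reg_next, hR.reg_out,
    hR.reg_rank, hR.reg_zero, hR.reg_one]
  refine ⟨by omega, hk, by omega, fun hlt => ⟨by omega, by omega, by omega, Or.inr ⟨?_, ?_⟩⟩,
    fun hlt => ⟨by omega, by omega, by omega, Or.inl
      ⟨L.length :: listWords L, (L.map I.edgesOf).toFinset, ?_, lists_listWords hL.1, hL.2.1, ?_⟩⟩⟩
  · refine output_eq ?_ ?_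
    · simp [RAMState.reg_setReg, RAMState.reg_setMem]
    · intro i hi
      have hi0 : i = 0 := by simpa using hi
      subst hi0
      simp [RAMState.reg_setReg, RAMState.reg_setMem, RAMState.mem_setMem]
  · rintro ⟨S, hS, hkS⟩
    have := hL.2.2 S hS
    omega
  · refine output_eq ?_ ?_
    · simp only [RAMState.reg_setReg, reduceIte, List.length_cons]
      omega
    · intro i hi
      simp only [RAMState.reg_setReg, Nat.reduceEqDiff, reduceIte, RAMState.mem_setReg,
        RAMState.reg_setMem, RAMState.mem_setMem]
      rcases i with _ | _ | i
      · simp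
      · simpa using hcount
      · rw [if_neg (by omega)]
        have : I.outBase + (i + 1 + 1) = I.outBase + 2 + i := by omega
        rw [this]
        exact hout i (by simpa using hi)
  · rw [hcard]
    omega

end SMInstance

theorem theorem1 :
    SolvableInLinearTime (fun I : SMInstance => I.encode)
      (fun I y => ∃ S, I.Lists y S ∧ I.IsLargestDisjointStable S) ∧
    SolvableInLinearTime (fun Ik : SMInstance × ℕ => Ik.1.encode ++ [Ik.2])
      (fun Ik y =>
        (∃ y' S, y = 1 :: y' ∧ Ik.1.Lists y' S ∧ Ik.1.IsDisjointStable S ∧ Ik.2 ≤ S.card) ∨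
        (y = [0] ∧ ¬ ∃ S, Ik.1.IsDisjointStable S ∧ Ik.2 ≤ S.card)) := by
  refine ⟨⟨StableMatchingProgram.findLargest, 500, fun I => ?_⟩,
    ⟨StableMatchingProgram.decideCount, 500, ?_⟩⟩
  · simp only [SMInstance.start_encode, SMInstance.length_encode]
    obtain ⟨t, s, he, ht, hS⟩ := I.findLargest_terminates
      (W := max (500 * (2 * (I.n * I.n) + 1)) (I.encode.foldr max 0)) (by omega)
    exact ⟨t, s, ht, he, hS⟩
  · rintro ⟨I, k⟩
    simp only [List.length_append, SMInstance.length_encode, List.length_singleton]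
    have hk : k ≤ (I.encode ++ [k]).foldr max 0 := by
      induction I.encode with
      | nil => simp
      | cons a l ih => exact ih.trans (le_max_right _ _)
    obtain ⟨t, s, he, ht, hS⟩ := I.decideCount_terminates (k := k)
      (W := max (500 * (2 * (I.n * I.n) + 1 + 1)) ((I.encode ++ [k]).foldr max 0)) (by omega)
      (hk.trans (le_max_right _ _))
    exact ⟨t, s, by omega, he, hS⟩
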